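/- **Setting.** Let $d\ge 2$ and let $\Omega\subset\mathbb R^d$ be a bounded Lipschitz domain with polyhedral boundary $\Gamma$, $\Gamma_D\subseteq\Gamma$ a non-empty closed subset, $f,g\in L^2(\Omega)$, $F(v)=\int_\Omega fv\,dx$ and $g(v):=\int_\Omega gv\,dx$. Let $\mathcal T_H$ be a mesh of $\Omega$ and $\mathcal T_h$ a refinement of it. Each is a regular subdivision into closed simplices, or into quadrilaterals/hexahedra with flat faces: the elements are $T=F_T(\hat T)$, where $\hat T$ is the unit simplex or the unit cube and $F_T$ is injective on $\hat T$ and affine, respectively multilinear; any two distinct elements meet in a common proper face of some dimension or not at all. Refinement means that the element maps of $\mathcal T_h$ are $F_T\circ S$ with $T\in\mathcal T_H$ and $S$ an affine map of $\hat T$ into itself (for cubes: onto a box with axis-parallel edges). Both meshes are shape regular with constant $\kappa$: $\kappa^{-1}\operatorname{diam}(T)|x-y|\le|F_T(x)-F_T(y)|\le\kappa\operatorname{diam}(T)|x-y|$ for $x,y\in\hat T$. $\Gamma_D$ is a union of $(d-1)$-dimensional faces of $\mathcal T_h$. Let $A$ be a measurable field of symmetric $d\times d$ matrices on $\Omega$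 with $\alpha|\xi|^2\le A(x)\xi\cdot\xi\le\beta|\xi|^2$ for a.e. $x$ and all $\xi$, where $0<\alpha\le\beta<\infty$, that extends continuously from the interior of each $T\in\mathcal T_h$ to $T$ (so that the traces below exist). Let $P_1(\mathcal T)$ be the space of functions $v$ such that, for each $T\in\mathcal T$, $v|_T\circ F_T$ is a polynomial of total degree $\le1$ (simplices), respectively of degree $\le 1$ in each variable (cubes), with no continuity between elements. Put $\mathcal V_h=P_1(\mathcal T_h)$, let $\nabla_h$ be the $\mathcal T_h$-piecewise gradient and let $\mathcal E$ be the set of those $(d-1)$-dimensional faces of $\mathcal T_h$ that are interior or contained in $\Gamma_D$. For $e\in\mathcal E$ let $h_e=\operatorname{diam}e$; for an interior face $e$ between $T^-$ and $T^+$ let $\nu$ be its unit normal pointing from $T^-$ to $T^+$, $[v]=v|_{T^-}-v|_{T^+}$ and $\{w\}=(w|_{T^-}+w|_{T^+})/2$; for a boundary face let $\nu$ be the outward normal, $[v]=v|_e$ and $\{w\}=w|_e$. For $\sigma>0$ set $$a_h(v,w)=(A\nabla_hv,\nabla_hw)_{L^2(\Omega)}-\sum_{e\in\mathcal E}\Big((\{\nu\cdot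 A\nabla v\},[w])_{L^2(e)}+(\{\nu\cdot A\nabla w\},[v])_{L^2(e)}-\tfrac{\sigma}{h_e}([v],[w])_{L^2(e)}\Big),$$ $$|||v|||_h^2=\|A^{1/2}\nabla_hv\|_{L^2(\Omega)}^2+\sum_{e\in\mathcal E}\tfrac{\sigma}{h_e}\|[v]\|_{L^2(e)}^2 .$$ Let $\Pi_H$ be the $L^2(\Omega)$-projection onto $P_1(\mathcal T_H)$ and $\mathcal V^{\rm f}=\{v\in\mathcal V_h:\Pi_Hv=0\}$. For $T\in\mathcal T_H$ let $\omega_T^1=\operatorname{int}T$ and $\omega_T^{L}=\operatorname{int}\bigcup\{T'\in\mathcal T_H:T'\cap\overline{\omega_T^{L-1}}\ne\emptyset\}$ for $L\ge2$, and let $\mathcal V^{\rm f}(\omega)=\{v\in\mathcal V^{\rm f}:v=0\text{ a.e. on }\Omega\setminus\omega\}$. Let $\lambda_{T,j}$ be the element-wise Lagrange basis functions of $P_1(\mathcal T_H)$ ($j$ runs over the vertices of $T$), let $\phi_{T,j}^L\in\mathcal V^{\rm f}(\omega_T^L)$ solve $a_h(\phi_{T,j}^L,w)=a_h(\lambda_{T,j},w)$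 for all $w\in\mathcal V^{\rm f}(\omega_T^L)$, and let $\mathcal V_H^{ms,L}=\operatorname{span}\{\lambda_{T,j}-\phi_{T,j}^L\}$. **Theorem.** For all $d\ge2$, each of the two kinds of meshes and every $\kappa$ there is a constant $C\ge 0$, and for all $0<\alpha\le\beta$ there is a $\sigma_0>0$ (depending only on $d$, the kind of mesh, $\kappa,\alpha,\beta$), such that in the above setting, with any penalty parameter $\sigma\ge\sigma_0$ and any integer $L\ge1$, the following holds. Let $u\in H^1_D(\Omega)=\{v\in H^1(\Omega): v|_{\Gamma_D}=0 \text{ in the sense of traces}\}$ satisfy $\int_\Omega A\nabla u\cdot\nabla v\,dx=F(v)$ for all $v\in H^1_D(\Omega)$; let $u_h\in\mathcal V_h$ satisfy $a_h(u_h,v)=F(v)$ for all $v\in\mathcal V_h$ and $u_H^{ms,L}\in\mathcal V_H^{ms,L}$ satisfy $a_h(u_H^{ms,L},v)=F(v)$ for all $v\in\mathcal V_H^{ms,L}$; let $\phi_h\in\mathcal V_h$ satisfy $a_h(v,\phi_h)=g(v)$ for all $v\in\mathcal V_h$ and $\phi_H^{ms,L}\in\mathcal V_H^{ms,L}$ satisfy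 $a_h(v,\phi_H^{ms,L})=g(v)$ for all $v\in\mathcal V_H^{ms,L}$. Then $$|g(u)-g(u_H^{ms,L})|\le|g(u)-g(u_h)|+C\,|||u_h-u_H^{ms,L}|||_h\,|||\phi_h-\phi_H^{ms,L}|||_h .$$ In particular, $C$ depends neither on the mesh sizes nor on $A$. -/

import Mathlib

open MeasureTheory Filter Topology Set

noncomputable section

namespace DGMultiscale

/-- The Euclidean space `ℝ^d`. -/
abbrev Eu (d : ℕ) : Type := EuclideanSpace ℝ (Fin d)

/-! ### Domains, Sobolev functions, the model problem -/

/-- Bounded Lipschitz domain with polygonal (polyhedral) boundary: near every boundary point,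
in suitable Cartesian coordinates, `Ω` is the strict hypograph of a Lipschitz function, and the
boundary is contained in finitely many hyperplanes. -/
structure IsPolyhedralLipschitzDomain {d : ℕ} (Ω : Set (Eu d)) : Prop where
  isOpen : IsOpen Ω
  isConnected : IsConnected Ω
  isBounded : Bornology.IsBounded Ω
  lipschitz : ∀ x₀ ∈ frontier Ω, ∃ (r : ℝ) (n : Eu d) (K : NNReal) (γ : Eu d → ℝ),
    0 < r ∧ ‖n‖ = 1 ∧ LipschitzWith K γ ∧
      ∀ y ∈ Metric.ball x₀ r, y ∈ Ω ↔ inner ℝ n y < γ (y - (inner ℝ n y : ℝ) • n)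
  polyhedral : ∃ S : Finset (Eu d × ℝ), (∀ p ∈ S, p.1 ≠ 0) ∧
    frontier Ω ⊆ ⋃ p ∈ S, {x | inner ℝ p.1 x = p.2}

/-- `G` is the weak gradient of `u` on the open set `Ω`. -/
def IsWeakGradient {d : ℕ} (Ω : Set (Eu d)) (u : Eu d → ℝ) (G : Eu d → Eu d) : Prop :=
  ∀ φ : Eu d → ℝ, ContDiff ℝ (⊤ : ℕ∞) φ → HasCompactSupport φ → tsupport φ ⊆ Ω →
    ∫ x in Ω, u x • gradient φ x = -∫ x in Ω, φ x • G x

/-- `u ∈ H¹(Ω)` with weak gradient `G`. -/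
structure MemH1 {d : ℕ} (Ω : Set (Eu d)) (u : Eu d → ℝ) (G : Eu d → Eu d) : Prop where
  memLp : MemLp u 2 (volume.restrict Ω)
  memLp_grad : MemLp G 2 (volume.restrict Ω)
  weakGrad : IsWeakGradient Ω u G

/-- `τ ∈ L²(∂Ω)` is the trace of `u ∈ H¹(Ω)` (with weak gradient `G`): the limit in `L²(∂Ω)` of
the restrictions to `∂Ω` of smooth functions that converge to `u` in `H¹(Ω)`. -/
def HasTrace {d : ℕ} (Ω : Set (Eu d)) (u : Eu d → ℝ) (G : Eu d → Eu d) (τ : Eu d → ℝ) : Prop :=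
  MemLp τ 2 ((μHE[d - 1]).restrict (frontier Ω)) ∧
  ∃ φ : ℕ → Eu d → ℝ, (∀ n, ContDiff ℝ (⊤ : ℕ∞) (φ n)) ∧
    Tendsto (fun n => eLpNorm (fun x => φ n x - u x) 2 (volume.restrict Ω)) atTop (𝓝 0) ∧
    Tendsto (fun n => eLpNorm (fun x => gradient (φ n) x - G x) 2 (volume.restrict Ω))
      atTop (𝓝 0) ∧
    Tendsto (fun n => eLpNorm (fun x => φ n x - τ x) 2 ((μHE[d - 1]).restrict (frontier Ω)))
      atTop (𝓝 0)

/-- `u ∈ H¹_D(Ω)`, with weak gradient `G`: the trace of `u` vanishes on `ΓD`. -/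
def MemH1D {d : ℕ} (Ω ΓD : Set (Eu d)) (u : Eu d → ℝ) (G : Eu d → Eu d) : Prop :=
  MemH1 Ω u G ∧ ∃ τ, HasTrace Ω u G τ ∧ ∀ᵐ x ∂((μHE[d - 1]).restrict ΓD), τ x = 0

/-- `u ∈ H¹_D(Ω)` and `∫_Ω A∇u·∇v = ∫_Ω f v` for all `v ∈ H¹_D(Ω)`. The coefficient is
a field of `d × d` matrices, regarded as linear maps of `ℝ^d`. -/
def IsWeakSolution {d : ℕ} (Ω ΓD : Set (Eu d)) (A : Eu d → Eu d →L[ℝ] Eu d) (f u : Eu d → ℝ) :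
    Prop :=
  ∃ G, MemH1D Ω ΓD u G ∧ ∀ v Gv, MemH1D Ω ΓD v Gv →
    ∫ x in Ω, inner ℝ (A x (G x)) (Gv x) = ∫ x in Ω, f x * v x

/-- The functional `v ↦ ∫_Ω g v` given by `g ∈ L²(Ω)`. -/
def functional {d : ℕ} (Ω : Set (Eu d)) (g v : Eu d → ℝ) : ℝ := ∫ x in Ω, g x * v x

/-! ### Reference elements -/

/-- The two kinds of meshes: simplicial, or quadrilateral / hexahedral. -/
inductive RefKind where
  | simplex
  | cube

/-- The reference simplex or the reference cube (closed). -/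
def refElem (d : ℕ) : RefKind → Set (Eu d)
  | .simplex => {x | (∀ i, 0 ≤ x i) ∧ ∑ i, x i ≤ 1}
  | .cube => {x | ∀ i, 0 ≤ x i ∧ x i ≤ 1}

/-- Labels of the `(d-1)`-dimensional faces of the reference element. -/
def FacetIdx (d : ℕ) : RefKind → Type
  | .simplex => Option (Fin d)
  | .cube => Fin d × Bool

instance (d : ℕ) : (K : RefKind) → Fintype (FacetIdx d K)
  | .simplex => inferInstanceAs (Fintype (Option (Fin d)))
  | .cube => inferInstanceAs (Fintype (Fin d × Bool))

/-- The (closed) `(d-1)`-dimensional faces of the reference element. -/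
def refFacet (d : ℕ) : (K : RefKind) → FacetIdx d K → Set (Eu d)
  | .simplex, none => {x ∈ refElem d .simplex | ∑ i, x i = 1}
  | .simplex, some i => {x ∈ refElem d .simplex | x i = 0}
  | .cube, (i, false) => {x ∈ refElem d .cube | x i = 0}
  | .cube, (i, true) => {x ∈ refElem d .cube | x i = 1}

/-- Labels of the vertices of the reference element: `d + 1` for the simplex (`none` is the
origin, `some i` the `i`-th unit vector), `2 ^ d` for the cube (`b` is the vertex with `i`-th
coordinate `1` if `b i`, and `0` otherwise). -/
def VertexIdx (d : ℕ) : RefKind → Type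
  | .simplex => Option (Fin d)
  | .cube => Fin d → Bool

/-- The Lagrange basis of the reference element associated with the vertices. -/
def refLagrange (d : ℕ) : (K : RefKind) → VertexIdx d K → Eu d → ℝ
  | .simplex, none => fun x => 1 - ∑ i, x i
  | .simplex, some i => fun x => x i
  | .cube, b => fun x => ∏ i, if (b : Fin d → Bool) i = true then x i else 1 - x i

/-- `𝓟_p` (total degree at most `p`) for simplices, `𝓠_p` (degree at most `p` in each variable)
for cubes. -/
def refPoly (d : ℕ) (K : RefKind) (p : ℕ) : Submodule ℝ (MvPolynomial (Fin d) ℝ) :=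
  match K with
  | .simplex => MvPolynomial.restrictTotalDegree (Fin d) ℝ p
  | .cube => MvPolynomial.restrictDegree (Fin d) ℝ p

/-- Evaluation of a polynomial at a point of `ℝ^d`. -/
def evalAt {d : ℕ} (x : Eu d) (q : MvPolynomial (Fin d) ℝ) : ℝ := MvPolynomial.eval (fun i => x i) q

/-! ### Meshes -/

/-- A regular subdivision of `Ω` into simplices, or into quadrilaterals / hexahedra, with its
element maps: affine maps of the reference simplex, multilinear maps of the reference cube. -/
structure Mesh {d : ℕ} (K : RefKind) (Ω : Set (Eu d)) where
  /-- number of elements -/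
  card : ℕ
  /-- the element maps -/
  map : Fin card → Eu d → Eu d
  map_poly : ∀ T i, ∃ q ∈ refPoly d K 1, ∀ x, map T x i = evalAt x q
  map_inj : ∀ T, InjOn (map T) (refElem d K)
  cover : closure Ω = ⋃ T, map T '' refElem d K
  subset : ∀ T, map T '' interior (refElem d K) ⊆ Ω
  /-- Two distinct elements meet in a common proper face of some dimension, possibly empty; the
  proper faces of the reference element are the intersections of facets. -/
  regular : ∀ T T', T ≠ T' → ∃ I J : Set (FacetIdx d K), I.Nonempty ∧ J.Nonempty ∧
    map T '' refElem d K ∩ map T' '' refElem d K = map T '' (⋂ k ∈ I, refFacet d K k) ∧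
    map T '' refElem d K ∩ map T' '' refElem d K = map T' '' (⋂ k ∈ J, refFacet d K k)
  /-- the element `T⁻` of a face -/
  minus : Set (Eu d) → Fin card
  /-- the element `T⁺` of an interior face -/
  plus : Set (Eu d) → Fin card
  /-- the unit normal of a face -/
  normal : Set (Eu d) → Eu d
  /-- Every face is a face of `T⁻`; it is flat, `normal` is its unit normal pointing out of `T⁻`,
  and `T⁻` lies on one side of it. -/
  minus_spec : ∀ T k, (∃ l, map (minus (map T '' refFacet d K k)) '' refFacet d K l =
      map T '' refFacet d K k) ∧ ‖normal (map T '' refFacet d K k)‖ = 1 ∧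
    ∀ x ∈ map T '' refFacet d K k, ∀ y ∈ map (minus (map T '' refFacet d K k)) '' refElem d K,
      inner ℝ (normal (map T '' refFacet d K k)) (y - x) ≤ 0
  /-- If two distinct elements share a face, then it is also a face of `T⁺ ≠ T⁻`, and `normal`
  points into `T⁺`. -/
  plus_spec : ∀ T k T' k', T ≠ T' → map T '' refFacet d K k = map T' '' refFacet d K k' →
    plus (map T '' refFacet d K k) ≠ minus (map T '' refFacet d K k) ∧
    (∃ l, map (plus (map T '' refFacet d K k)) '' refFacet d K l = map T '' refFacet d K k) ∧
    ∀ x ∈ map T '' refFacet d K k, ∀ y ∈ map (plus (map T '' refFacet d K k)) '' refElem d K,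
      0 ≤ inner ℝ (normal (map T '' refFacet d K k)) (y - x)

namespace Mesh

variable {d : ℕ} {K : RefKind} {Ω : Set (Eu d)} (M : Mesh K Ω)

/-- The closed element. -/
def elem (T : Fin M.card) : Set (Eu d) := M.map T '' refElem d K

/-- The open element. -/
def cell (T : Fin M.card) : Set (Eu d) := M.map T '' interior (refElem d K)

/-- The faces of an element, of dimension `d - 1`. -/
def facet (T : Fin M.card) (k : FacetIdx d K) : Set (Eu d) := M.map T '' refFacet d K k

open scoped Classical in
/-- The set `𝓔` of all faces of dimension `d - 1`. -/
def faces : Finset (Set (Eu d)) :=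
  Finset.univ.image fun p : Fin M.card × FacetIdx d K => M.facet p.1 p.2

/-- The face `e` is shared by two distinct elements. -/
def IsInterior (e : Set (Eu d)) : Prop :=
  ∃ T k T' k', T ≠ T' ∧ M.facet T k = e ∧ M.facet T' k' = e

open scoped Classical in
/-- `𝓔(Ω) ∪ 𝓔(Γ_D)`. -/
def dgFaces (ΓD : Set (Eu d)) : Finset (Set (Eu d)) :=
  M.faces.filter fun e => M.IsInterior e ∨ e ⊆ ΓD

/-- Shape regularity with constant `κ`: after scaling by the diameter, the element maps are
bi-Lipschitz with constant `κ`. -/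
def ShapeRegular (κ : ℝ) : Prop :=
  ∀ T, ∀ x ∈ refElem d K, ∀ y ∈ refElem d K,
    Metric.diam (M.elem T) * dist x y ≤ κ * dist (M.map T x) (M.map T y) ∧
    dist (M.map T x) (M.map T y) ≤ κ * Metric.diam (M.elem T) * dist x y

/-- The boundary part `ΓD` is resolved by the mesh: it is a union of faces. -/
def Resolves (ΓD : Set (Eu d)) : Prop :=
  ∃ S : Finset (Set (Eu d)), S ⊆ M.faces ∧ ΓD = ⋃ e ∈ S, e

/-- Piecewise polynomials `P_p(𝓣)`. Such a function may jump across faces; its values on the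
union of the faces (a null set) are immaterial. -/
def space (p : ℕ) : Submodule ℝ (Eu d → ℝ) where
  carrier := {v | ∀ T, ∃ q ∈ refPoly d K p, ∀ x ∈ interior (refElem d K),
    v (M.map T x) = evalAt x q}
  zero_mem' := fun _ => ⟨0, Submodule.zero_mem _, fun x _ => by simp [evalAt]⟩
  add_mem' := by
    intro v w hv hw T
    obtain ⟨q, hq, h⟩ := hv T
    obtain ⟨q', hq', h'⟩ := hw T
    exact ⟨q + q', Submodule.add_mem _ hq hq', fun x hx => by
      simp only [Pi.add_apply, h x hx, h' x hx, evalAt, map_add]⟩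
  smul_mem' := by
    intro c v hv T
    obtain ⟨q, hq, h⟩ := hv T
    exact ⟨c • q, Submodule.smul_mem _ c hq, fun x hx => by
      simp only [Pi.smul_apply, h x hx, evalAt, MvPolynomial.smul_eval, smul_eq_mul]⟩

open scoped Classical in
/-- The piecewise gradient `∇_𝓣 v` (set to zero on the union of the faces). -/
def brokenGrad (v : Eu d → ℝ) (x : Eu d) : Eu d :=
  if x ∈ ⋃ T, M.cell T then gradient v x else 0

/-- The trace on the closed element `T` of a function given on its interior: its limit from
inside `T`. -/
def traceFrom {X : Type} [TopologicalSpace X] (T : Fin M.card) (w : Eu d → X) : Eu d → X :=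
  extendFrom (M.cell T) w

open scoped Classical in
/-- The jump `[v]` across the face `e`. -/
def jump (v : Eu d → ℝ) (e : Set (Eu d)) (x : Eu d) : ℝ :=
  if M.IsInterior e then M.traceFrom (M.minus e) v x - M.traceFrom (M.plus e) v x
  else M.traceFrom (M.minus e) v x

open scoped Classical in
/-- The average `{ν · A∇v}` on the face `e`. -/
def avgFlux (A : Eu d → Eu d →L[ℝ] Eu d) (v : Eu d → ℝ) (e : Set (Eu d)) (x : Eu d) : ℝ :=
  if M.IsInterior e then
    (inner ℝ (M.normal e) (M.traceFrom (M.minus e) (fun y => A y (M.brokenGrad v y)) x) +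
      inner ℝ (M.normal e) (M.traceFrom (M.plus e) (fun y => A y (M.brokenGrad v y)) x)) / 2
  else inner ℝ (M.normal e) (M.traceFrom (M.minus e) (fun y => A y (M.brokenGrad v y)) x)

/-- The diffusion coefficient is symmetric with spectral bounds `α, β` almost everywhere in `Ω`.
So that `A∇v` has traces on the faces for piecewise polynomial `v`, it extends continuously from
the interior of each element of the mesh to the closed element. -/
structure IsDiffusion (A : Eu d → Eu d →L[ℝ] Eu d) (α β : ℝ) : Prop where
  aestronglyMeasurable : AEStronglyMeasurable A (volume.restrict Ω)
  symm : ∀ᵐ x ∂(volume.restrict Ω), ∀ v w, inner ℝ (A x v) w = inner ℝ v (A x w)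
  bounds : ∀ᵐ x ∂(volume.restrict Ω), ∀ v,
    α * ‖v‖ ^ 2 ≤ inner ℝ (A x v) v ∧ inner ℝ (A x v) v ≤ β * ‖v‖ ^ 2
  piecewise : ∀ T, ∃ B : Eu d → Eu d →L[ℝ] Eu d, ContinuousOn B (M.elem T) ∧ EqOn A B (M.cell T)

/-- The symmetric interior penalty form `a_h` with penalty parameter `σ`. -/
def form (ΓD : Set (Eu d)) (A : Eu d → Eu d →L[ℝ] Eu d) (σ : ℝ) (u v : Eu d → ℝ) : ℝ :=
  (∫ x in Ω, inner ℝ (A x (M.brokenGrad u x)) (M.brokenGrad v x)) -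
    ∑ e ∈ M.dgFaces ΓD,
      ((∫ x in e, M.avgFlux A u e x * M.jump v e x ∂μHE[d - 1]) +
        (∫ x in e, M.avgFlux A v e x * M.jump u e x ∂μHE[d - 1]) -
        σ / Metric.diam e * ∫ x in e, M.jump u e x * M.jump v e x ∂μHE[d - 1])

/-- The energy norm
`(‖A^{1/2} ∇_h v‖²_{L²(Ω)} + ∑_e σ / h_e ‖[v]‖²_{L²(e)})^{1/2}`; note `|A^{1/2} ξ|² = Aξ·ξ`. -/
def energyNorm (ΓD : Set (Eu d)) (A : Eu d → Eu d →L[ℝ] Eu d) (σ : ℝ) (v : Eu d → ℝ) : ℝ :=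
  Real.sqrt ((∫ x in Ω, inner ℝ (A x (M.brokenGrad v x)) (M.brokenGrad v x)) +
    ∑ e ∈ M.dgFaces ΓD, σ / Metric.diam e * ∫ x in e, M.jump v e x ^ 2 ∂μHE[d - 1])

/-- `w` is the `L²(Ω)`-projection `Π_p(𝓣) v` of `v` onto the piecewise polynomials. -/
def IsL2Projection (p : ℕ) (v w : Eu d → ℝ) : Prop :=
  w ∈ M.space p ∧ ∀ z ∈ M.space p, ∫ x in Ω, (v x - w x) * z x = 0

open scoped Classical in
/-- The element-wise Lagrange basis function `λ_{T,j}`, supported on `T`. -/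
def lagrange (T : Fin M.card) (j : VertexIdx d K) (x : Eu d) : ℝ :=
  if x ∈ M.cell T then refLagrange d K j (Function.invFunOn (M.map T) (refElem d K) x) else 0

/-- The element patches `ω_T^L`, `L ≥ 1` (the value at `L = 0` is not used). -/
def patch (T : Fin M.card) : ℕ → Set (Eu d)
  | 0 => ∅
  | 1 => interior (M.elem T)
  | L + 2 => interior (⋃ T' ∈ {T' | (M.elem T' ∩ closure (patch T (L + 1))).Nonempty}, M.elem T')

/-- `Mh` is a refinement of `M`: the map of every fine element is the map of a coarse element
composed with an affine map of the reference element into itself, which for cubes takes boxes with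
axis-parallel edges to boxes with axis-parallel edges. -/
def IsRefinedBy (Mh : Mesh K Ω) : Prop :=
  ∀ t, ∃ T, ∃ S : Eu d →ᵃ[ℝ] Eu d, MapsTo S (refElem d K) (refElem d K) ∧
    (K = .cube → ∃ π : Equiv.Perm (Fin d), ∀ i, ∃ a b : ℝ, ∀ x, S x i = a + b * x (π i)) ∧
    ∀ x ∈ refElem d K, Mh.map t x = M.map T (S x)

end Mesh

/-! ### The multiscale method -/

section Multiscale

variable {d : ℕ} {K : RefKind} {Ω : Set (Eu d)}

/-- The fine scale space `𝓥^f = {v ∈ 𝓥_h : Π_H v = 0}`. -/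
def fineSpace (MH Mh : Mesh K Ω) : Set (Eu d → ℝ) :=
  {v | v ∈ Mh.space 1 ∧ MH.IsL2Projection 1 v 0}

/-- `𝓥^f(U) = {v ∈ 𝓥^f : v = 0 on Ω \ U}`. -/
def fineSpaceOn (MH Mh : Mesh K Ω) (U : Set (Eu d)) : Set (Eu d → ℝ) :=
  {v | v ∈ fineSpace MH Mh ∧ ∀ᵐ x ∂(volume.restrict (Ω \ U)), v x = 0}

/-- `φ T j` are the localized correctors `φ_{T,j}^L`. -/
def AreCorrectors (MH Mh : Mesh K Ω) (ΓD : Set (Eu d)) (A : Eu d → Eu d →L[ℝ] Eu d) (σ : ℝ)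
    (L : ℕ) (φ : Fin MH.card → VertexIdx d K → Eu d → ℝ) : Prop :=
  ∀ T j, φ T j ∈ fineSpaceOn MH Mh (MH.patch T L) ∧
    ∀ w ∈ fineSpaceOn MH Mh (MH.patch T L),
      Mh.form ΓD A σ (φ T j) w = Mh.form ΓD A σ (MH.lagrange T j) w

/-- The multiscale space `𝓥_H^{ms,L}`, spanned by the `λ_{T,j} - φ_{T,j}^L`. -/
def msSpace (MH : Mesh K Ω) (φ : Fin MH.card → VertexIdx d K → Eu d → ℝ) :
    Submodule ℝ (Eu d → ℝ) :=
  Submodule.span ℝ (Set.range fun p : Fin MH.card × VertexIdx d K =>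
    MH.lagrange p.1 p.2 - φ p.1 p.2)

/-- `u ∈ V` solves the (primal) Galerkin problem `a_h(u, v) = ∫_Ω f v` for all `v ∈ V`. -/
def IsGalerkin (Mh : Mesh K Ω) (ΓD : Set (Eu d)) (A : Eu d → Eu d →L[ℝ] Eu d) (σ : ℝ)
    (f : Eu d → ℝ) (V : Submodule ℝ (Eu d → ℝ)) (u : Eu d → ℝ) : Prop :=
  u ∈ V ∧ ∀ v ∈ V, Mh.form ΓD A σ u v = functional Ω f v

/-- `φ ∈ V` solves the dual Galerkin problem `a_h(v, φ) = g(v)` for all `v ∈ V`. -/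
def IsDualGalerkin (Mh : Mesh K Ω) (ΓD : Set (Eu d)) (A : Eu d → Eu d →L[ℝ] Eu d) (σ : ℝ)
    (g : Eu d → ℝ) (V : Submodule ℝ (Eu d → ℝ)) (φ : Eu d → ℝ) : Prop :=
  φ ∈ V ∧ ∀ v ∈ V, Mh.form ΓD A σ v φ = functional Ω g v

end Multiscale

end DGMultiscale

end

/-!
If `V ≤ V_h` and `u_V`, `φ_V` are the Galerkin solutions in `V`, then Galerkin orthogonality gives
`g(u_h) - g(u_V) = a_h(u_h - u_V, φ_h) = a_h(u_h - u_V, φ_h - φ_V)`, so the estimate is the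
boundedness of `a_h` in the energy norm. The volume and penalty terms are bounded by the
Cauchy–Schwarz inequality. For the flux terms one transports polynomials to the reference element,
where all norms on a finite-dimensional space are equivalent; scaling back gives
`h_e ‖∇v‖²_{L²(e)} ≤ C ‖∇v‖²_{L²(T)}`, with `C` depending only on the dimension, the degree, the
kind of mesh and the shape regularity. The factor `β² / α` by which the coefficient enters the flux
is absorbed into the penalty parameter, which is why the bound is uniform in `A` for `σ ≥ β² / α`.

The multiscale space is a subspace of `V_h` because the coarse Lagrange functions are piecewise
polynomial on the refined mesh: multilinearity survives the change of variables in a cube since that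
change of variables is diagonal up to a permutation of the coordinates.
-/

noncomputable section

namespace DGMultiscale

open scoped NNReal

section Chart

theorem lipschitzOnWith_invFunOn {X Y : Type*} [PseudoEMetricSpace X] [Nonempty X]
    [PseudoEMetricSpace Y] {F : X → Y} {s : Set X} {c : ℝ≥0}
    (hF : AntilipschitzWith c (s.domRestrict F)) :
    LipschitzOnWith c (Function.invFunOn F s) (F '' s) :=
  lipschitzOnWith_iff_restrict.2 <| hF.to_rightInvOn'
    (fun _ hy => Function.invFunOn_mem hy) fun _ hy => Function.invFunOn_eq hy

theorem norm_le_mul_norm_of_hasFDerivAt {E G : Type*} [NormedAddCommGroup E] [NormedSpace ℝ E]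
    [NormedAddCommGroup G] [NormedSpace ℝ G] {F : E → G} {F' : E →L[ℝ] G} {s : Set E} {c : ℝ≥0}
    {x : E} (hF : AntilipschitzWith c (s.domRestrict F)) (hF' : HasFDerivAt F F' x) (hs : s ∈ 𝓝 x)
    (ξ : E) : ‖ξ‖ ≤ c * ‖F' ξ‖ := by
  have hslope := (hF'.hasLineDerivAt ξ).tendsto_slope_zero.norm
  refine ge_of_tendsto (hslope.const_mul (c : ℝ)) ?_
  have hline : Tendsto (fun t : ℝ => x + t • ξ) (𝓝[≠] 0) (𝓝 x) :=
    (Continuous.tendsto' (by fun_prop) 0 x (by simp)).mono_left nhdsWithin_le_nhds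
  filter_upwards [hline.eventually hs, self_mem_nhdsWithin] with t ht ht0
  have hdist : ‖t‖ * ‖ξ‖ ≤ c * ‖F (x + t • ξ) - F x‖ := by
    simpa [Subtype.dist_eq, dist_eq_norm, norm_smul] using
      hF.le_mul_dist ⟨x + t • ξ, ht⟩ ⟨x, mem_of_mem_nhds hs⟩
  rw [norm_smul, norm_inv, mul_left_comm, inv_mul_eq_div, le_div_iff₀ (norm_pos_iff.2 ht0)]
  linarith

variable {E : Type*} [NormedAddCommGroup E] [NormedSpace ℝ E] {F : E → E} {s : Set E} {c : ℝ≥0}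

/-- A parametrization of `F '' s` by the set `s`, whose inverse is Lipschitz with constant `c`.
Points of `s` are required to be limits of interior points, so that the bounds on the derivative of
`F` that follow from the antilipschitz property hold on all of `s`. -/
structure IsChart (F : E → E) (s : Set E) (c : ℝ≥0) : Prop where
  contDiff : ContDiff ℝ 1 F
  subset_closure_interior : s ⊆ closure (interior s)
  antilipschitz : AntilipschitzWith c (s.domRestrict F)

/-- The derivative of `q ∘ F⁻¹` on the image `F '' s`, defined by the chain rule. It makes sense up
to the boundary of `F '' s`. -/
def pulledDeriv (F : E → E) (s : Set E) (q : E → ℝ) (y : E) : E →L[ℝ] ℝ :=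
  (fderiv ℝ q (Function.invFunOn F s y)).comp (fderiv ℝ F (Function.invFunOn F s y)).inverse

namespace IsChart

theorem injOn (hF : IsChart F s c) : InjOn F s :=
  injOn_iff_injective.2 hF.antilipschitz.injective

theorem hasFDerivAt (hF : IsChart F s c) (x : E) : HasFDerivAt F (fderiv ℝ F x) x :=
  (hF.contDiff.differentiable one_ne_zero x).hasFDerivAt

theorem norm_le_mul_norm_fderiv (hF : IsChart F s c) {x : E} (hx : x ∈ s) (ξ : E) :
    ‖ξ‖ ≤ c * ‖fderiv ℝ F x ξ‖ := by
  have hclosed : IsClosed {x | ‖ξ‖ ≤ c * ‖fderiv ℝ F x ξ‖} :=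
    isClosed_le continuous_const <| continuous_const.mul
      ((hF.contDiff.continuous_fderiv one_ne_zero).clm_apply continuous_const).norm
  refine closure_minimal (fun z hz => ?_) hclosed (hF.subset_closure_interior hx)
  exact norm_le_mul_norm_of_hasFDerivAt hF.antilipschitz (hF.hasFDerivAt z)
    (mem_interior_iff_mem_nhds.1 hz) ξ

variable [FiniteDimensional ℝ E]

theorem isInvertible_fderiv (hF : IsChart F s c) {x : E} (hx : x ∈ s) :
    (fderiv ℝ F x).IsInvertible := by
  have hinj : Function.Injective (fderiv ℝ F x : E →ₗ[ℝ] E) := by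
    refine (injective_iff_map_eq_zero _).2 fun ξ hξ => norm_le_zero_iff.1 ?_
    simpa [show fderiv ℝ F x ξ = 0 from hξ] using hF.norm_le_mul_norm_fderiv hx ξ
  exact ⟨(LinearEquiv.ofInjectiveEndo _ hinj).toContinuousLinearEquiv,
    ContinuousLinearMap.ext fun _ => rfl⟩

theorem norm_inverse_fderiv_le (hF : IsChart F s c) {x : E} (hx : x ∈ s) :
    ‖(fderiv ℝ F x).inverse‖ ≤ c := by
  refine ContinuousLinearMap.opNorm_le_bound _ c.2 fun ξ => ?_
  obtain ⟨e, he⟩ := hF.isInvertible_fderiv hx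
  simpa [← he] using hF.norm_le_mul_norm_fderiv hx (e.symm ξ)

theorem map_nhds_eq (hF : IsChart F s c) {x : E} (hx : x ∈ s) : map F (𝓝 x) = 𝓝 (F x) := by
  obtain ⟨e, he⟩ := hF.isInvertible_fderiv hx
  have hstrict : HasStrictFDerivAt F (e : E →L[ℝ] E) x :=
    he ▸ hF.contDiff.contDiffAt.hasStrictFDerivAt one_ne_zero
  exact hstrict.map_nhds_eq_of_equiv

theorem isOpen_image_interior (hF : IsChart F s c) : IsOpen (F '' interior s) := by
  refine isOpen_iff_mem_nhds.2 ?_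
  rintro _ ⟨x, hx, rfl⟩
  rw [← hF.map_nhds_eq (interior_subset hx)]
  exact image_mem_map (isOpen_interior.mem_nhds hx)

theorem hasFDerivAt_invFunOn (hF : IsChart F s c) {y : E} (hy : y ∈ F '' interior s) :
    HasFDerivAt (Function.invFunOn F s) (fderiv ℝ F (Function.invFunOn F s y)).inverse y := by
  have hsub : F '' interior s ⊆ F '' s := image_mono interior_subset
  have hnhds := hF.isOpen_image_interior.mem_nhds hy
  obtain ⟨e, he⟩ := hF.isInvertible_fderiv (Function.invFunOn_mem (hsub hy))
  rw [← he, ContinuousLinearMap.inverse_equiv]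
  refine HasFDerivAt.of_local_left_inverse (f := F) ?_ (he ▸ hF.hasFDerivAt _) ?_
  · exact (lipschitzOnWith_invFunOn hF.antilipschitz).continuousOn.continuousAt
      (mem_of_superset hnhds hsub)
  · filter_upwards [hnhds] with z hz using Function.invFunOn_eq (hsub hz)

variable {q : E → ℝ}

theorem continuousOn_pulledDeriv (hF : IsChart F s c) (hq : ContDiff ℝ 1 q) :
    ContinuousOn (pulledDeriv F s q) (F '' s) := by
  have hcont := (lipschitzOnWith_invFunOn hF.antilipschitz).continuousOn
  refine ((hq.continuous_fderiv one_ne_zero).comp_continuousOn hcont).clm_comp fun y hy => ?_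
  have hinv := hF.isInvertible_fderiv (Function.invFunOn_mem hy)
  exact (hinv.contDiffAt_map_inverse (n := 0)).continuousAt.comp_continuousWithinAt
    (f := fun z => fderiv ℝ F (Function.invFunOn F s z))
    ((hF.contDiff.continuous_fderiv one_ne_zero).continuousAt.comp_continuousWithinAt (hcont y hy))

theorem hasFDerivAt_of_comp_eq (hF : IsChart F s c) (hq : ContDiff ℝ 1 q) {v : E → ℝ}
    (hv : ∀ x ∈ interior s, v (F x) = q x) {y : E} (hy : y ∈ F '' interior s) :
    HasFDerivAt v (pulledDeriv F s q y) y := by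
  refine ((hq.differentiable one_ne_zero _).hasFDerivAt.comp y
    (hF.hasFDerivAt_invFunOn hy)).congr_of_eventuallyEq ?_
  filter_upwards [hF.isOpen_image_interior.mem_nhds hy]
  rintro _ ⟨x, hx, rfl⟩
  rw [hv x hx, Function.comp_apply, hF.injOn.leftInvOn_invFunOn (interior_subset hx)]

theorem norm_pulledDeriv_le (hF : IsChart F s c) {x : E} (hx : x ∈ s) :
    ‖pulledDeriv F s q (F x)‖ ≤ ‖fderiv ℝ q x‖ * c := by
  rw [pulledDeriv, hF.injOn.leftInvOn_invFunOn hx]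
  refine (ContinuousLinearMap.opNorm_comp_le _ _).trans ?_
  gcongr
  exact hF.norm_inverse_fderiv_le hx

theorem norm_fderiv_le_mul_norm_pulledDeriv (hF : IsChart F s c) {b : ℝ≥0}
    (hlip : LipschitzOnWith b F s) {x : E} (hx : x ∈ interior s) :
    ‖fderiv ℝ q x‖ ≤ ‖pulledDeriv F s q (F x)‖ * b := by
  have hchain : fderiv ℝ q x = (pulledDeriv F s q (F x)).comp (fderiv ℝ F x) := by
    obtain ⟨e, he⟩ := hF.isInvertible_fderiv (interior_subset hx)
    rw [pulledDeriv, hF.injOn.leftInvOn_invFunOn (interior_subset hx), ← he,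
      ContinuousLinearMap.inverse_equiv]
    ext ξ
    simp
  rw [hchain]
  refine (ContinuousLinearMap.opNorm_comp_le _ _).trans ?_
  gcongr
  exact (hF.hasFDerivAt x).le_of_lipschitzOn (mem_interior_iff_mem_nhds.1 hx) hlip

end IsChart

end Chart

section Measure

theorem euclideanHausdorffMeasure_image_le {X Y : Type*} [MetricSpace X] [MeasurableSpace X]
    [BorelSpace X] [MetricSpace Y] [MeasurableSpace Y] [BorelSpace Y] {f : X → Y} {s : Set X}
    {c : ℝ≥0} (hf : LipschitzOnWith c f s) (m : ℕ) :
    μHE[m] (f '' s) ≤ (c : ENNReal) ^ m * μHE[m] s := by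
  have hμH := hf.hausdorffMeasure_image_le (d := m) m.cast_nonneg
  rw [ENNReal.rpow_natCast] at hμH
  simp only [Measure.euclideanHausdorffMeasure_def, Measure.smul_apply]
  rw [mul_smul_comm]
  exact smul_le_smul_of_nonneg_left hμH zero_le

theorem map_restrict_euclideanHausdorffMeasure_le {X Y : Type*} [MetricSpace X]
    [MeasurableSpace X] [BorelSpace X] [MetricSpace Y] [MeasurableSpace Y] [BorelSpace Y]
    {F : X → Y} {s : Set X} {c : ℝ≥0} (hF : Measurable F)
    (hs : AntilipschitzWith c (s.domRestrict F)) (m : ℕ) :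
    (μHE[m].restrict s).map F ≤ (c : ENNReal) ^ m • μHE[m].restrict (F '' s) := by
  refine Measure.le_iff.2 fun B hB => ?_
  rw [Measure.map_apply hF hB, Measure.restrict_apply (hF hB), Measure.smul_apply,
    Measure.restrict_apply hB, smul_eq_mul]
  rcases isEmpty_or_nonempty X with hX | hX
  · simp [Set.eq_empty_of_isEmpty]
  have hleft := (injOn_iff_injective.2 hs.injective).leftInvOn_invFunOn
  have himage : Function.invFunOn F s '' (B ∩ F '' s) = F ⁻¹' B ∩ s := by
    rw [inter_comm, ← image_inter_preimage, hleft.image_image' inter_subset_left, inter_comm]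
  rw [← himage]
  exact euclideanHausdorffMeasure_image_le
    ((lipschitzOnWith_invFunOn hs).mono inter_subset_right) m

theorem euclideanHausdorffMeasure_hyperplane_lt_top {d : ℕ} {S : Set (Eu d)}
    (hS : Bornology.IsBounded S) {n : Eu d} (hn : n ≠ 0) {c : ℝ}
    (h : ∀ x ∈ S, inner ℝ n x = c) : μHE[d - 1] S < ⊤ := by
  rcases S.eq_empty_or_nonempty with rfl | ⟨p, hp⟩
  · simp
  let V : Submodule ℝ (Eu d) := (ℝ ∙ n)ᗮ
  have hrank : Module.finrank ℝ V = d - 1 := by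
    have hadd : Module.finrank ℝ (ℝ ∙ n) + Module.finrank ℝ V = _ :=
      Submodule.finrank_add_finrank_orthogonal (ℝ ∙ n)
    rw [finrank_span_singleton hn, finrank_euclideanSpace_fin] at hadd
    omega
  let ι : V → Eu d := fun w => p + w
  have hι : Isometry ι := (IsometryEquiv.addLeft p).isometry.comp V.subtypeₗᵢ.isometry
  have himage : ι '' (ι ⁻¹' S) = S := by
    refine image_preimage_eq_of_subset fun x hx => ⟨⟨x - p, ?_⟩, add_sub_cancel p x⟩
    rw [Submodule.mem_orthogonal_singleton_iff_inner_right, inner_sub_right, h x hx, h p hp,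
      sub_self]
  rw [← himage, hι.euclideanHausdorffMeasure_image, ← hrank]
  exact (hι.antilipschitz.isBounded_preimage hS).measure_lt_top

theorem isOpenPosMeasure_comap_subtype {E : Type*} [TopologicalSpace E] [MeasurableSpace E]
    [BorelSpace E] {μ : Measure E} [μ.IsOpenPosMeasure] {s : Set E} (hs : MeasurableSet s)
    (hcl : s ⊆ closure (interior s)) :
    (μ.comap (Subtype.val : s → E)).IsOpenPosMeasure := by
  refine ⟨fun U hU ⟨x, hx⟩ h0 => ?_⟩
  obtain ⟨V, hV, rfl⟩ := isOpen_induced_iff.1 hU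
  rw [comap_subtype_coe_apply hs, Subtype.image_preimage_coe] at h0
  obtain ⟨y, hyV, hys⟩ := mem_closure_iff.1 (hcl x.2) V hV hx
  refine ((hV.inter isOpen_interior).measure_pos μ ⟨y, hyV, hys⟩).ne' (measure_mono_null ?_ h0)
  exact fun z hz => ⟨interior_subset hz.2, hz.1⟩

theorem norm_sq_toLp_two {X G : Type*} [TopologicalSpace X] [CompactSpace X] [MeasurableSpace X]
    [BorelSpace X] [NormedAddCommGroup G] [NormedSpace ℝ G] [SecondCountableTopologyEither X G]
    (μ : Measure X) [IsFiniteMeasure μ] (f : C(X, G)) :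
    ‖ContinuousMap.toLp 2 μ ℝ f‖ ^ 2 = ∫ x, ‖f x‖ ^ 2 ∂μ := by
  have hf := (Lp.memLp (ContinuousMap.toLp 2 μ ℝ f)).ae_eq (ContinuousMap.coeFn_toLp (𝕜 := ℝ) μ f)
  rw [Lp.norm_def, eLpNorm_congr_ae (ContinuousMap.coeFn_toLp μ f),
    hf.eLpNorm_eq_integral_rpow_norm two_ne_zero ENNReal.ofNat_ne_top,
    ENNReal.toReal_ofReal (by positivity)]
  simp only [ENNReal.toReal_ofNat, Real.rpow_ofNat]
  rw [← Real.rpow_natCast, ← Real.rpow_mul (by positivity)]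
  norm_num

theorem exists_norm_sq_le_integral {X G : Type*} [TopologicalSpace X] [CompactSpace X]
    [MeasurableSpace X] [BorelSpace X] [NormedAddCommGroup G] [NormedSpace ℝ G]
    [SecondCountableTopologyEither X G]
    (μ : Measure X) [IsFiniteMeasure μ] [μ.IsOpenPosMeasure] (W : Submodule ℝ C(X, G))
    [FiniteDimensional ℝ W] :
    ∃ C : ℝ, 0 ≤ C ∧ ∀ f ∈ W, ‖f‖ ^ 2 ≤ C * ∫ x, ‖f x‖ ^ 2 ∂μ := by
  let toL2 : W →ₗ[ℝ] Lp G 2 μ := (ContinuousMap.toLp 2 μ ℝ).toLinearMap ∘ₗ W.subtype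
  have hker : LinearMap.ker toL2 = ⊥ :=
    LinearMap.ker_eq_bot.2 ((ContinuousMap.toLp_injective μ).comp Subtype.val_injective)
  obtain ⟨c, -, hc⟩ := toL2.exists_antilipschitzWith hker
  refine ⟨(c : ℝ) ^ 2, by positivity, fun f hf => ?_⟩
  have hnorm : ‖toL2 ⟨f, hf⟩‖ ^ 2 = ∫ x, ‖f x‖ ^ 2 ∂μ := norm_sq_toLp_two μ f
  rw [← hnorm, ← mul_pow]
  gcongr
  simpa using hc.le_mul_dist ⟨f, hf⟩ 0

end Measure

section RefElem

variable {d : ℕ} {K : RefKind}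

theorem convex_refElem (d : ℕ) (K : RefKind) : Convex ℝ (refElem d K) := by
  cases K with
  | simplex =>
    simp only [refElem, ofPred_and, ofPred_forall]
    refine (convex_iInter fun i => convex_halfSpace_ge (EuclideanSpace.proj i).isLinear 0).inter ?_
    simpa using! convex_halfSpace_le (∑ i, EuclideanSpace.proj (𝕜 := ℝ) i).isLinear 1
  | cube =>
    simp only [refElem, ofPred_and, ofPred_forall]
    exact convex_iInter fun i => (convex_halfSpace_ge (EuclideanSpace.proj i).isLinear 0).inter
      (convex_halfSpace_le (EuclideanSpace.proj i).isLinear 1)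

theorem isClosed_refElem_simplex (d : ℕ) : IsClosed (refElem d .simplex) := by
  simp only [refElem, ofPred_and, ofPred_forall]
  exact (isClosed_iInter fun i => isClosed_le (by fun_prop) (by fun_prop)).inter
    (isClosed_le (by fun_prop) (by fun_prop))

theorem isCompact_refElem (d : ℕ) (K : RefKind) : IsCompact (refElem d K) := by
  have hcube : IsCompact (refElem d .cube) := by
    convert (PiLp.homeomorph 2 fun _ : Fin d => ℝ).isCompact_preimage.2
      (isCompact_Icc (a := (0 : Fin d → ℝ)) (b := 1)) using 1
    ext x
    exact ⟨fun hx => ⟨fun i => (hx i).1, fun i => (hx i).2⟩, fun hx i => ⟨hx.1 i, hx.2 i⟩⟩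
  cases K with
  | simplex =>
    exact hcube.of_isClosed_subset (isClosed_refElem_simplex d) fun x hx i =>
      ⟨hx.1 i, (Finset.single_le_sum (fun j _ => hx.1 j) (Finset.mem_univ i)).trans hx.2⟩
  | cube => exact hcube

theorem interior_refElem_nonempty (d : ℕ) (K : RefKind) : (interior (refElem d K)).Nonempty := by
  cases K with
  | simplex =>
    have hopen : IsOpen {x : Eu d | (∀ i, 0 < x i) ∧ ∑ i, x i < 1} := by
      simp only [ofPred_and, ofPred_forall]
      exact (isOpen_iInter_of_finite fun i => isOpen_lt (by fun_prop) (by fun_prop)).inter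
        (isOpen_lt (by fun_prop) (by fun_prop))
    have hsub : {x : Eu d | (∀ i, 0 < x i) ∧ ∑ i, x i < 1} ⊆ refElem d .simplex :=
      fun x hx => ⟨fun i => (hx.1 i).le, hx.2.le⟩
    refine ⟨WithLp.toLp 2 fun _ => ((d : ℝ) + 1)⁻¹,
      interior_maximal hsub hopen ⟨fun i => by positivity, ?_⟩⟩
    simp only [Finset.sum_const, Finset.card_univ, Fintype.card_fin, nsmul_eq_mul]
    rw [mul_inv_lt_iff₀ (by positivity)]
    linarith
  | cube =>
    have hopen : IsOpen {x : Eu d | ∀ i, 0 < x i ∧ x i < 1} := by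
      simp only [ofPred_and, ofPred_forall]
      exact isOpen_iInter_of_finite fun i => (isOpen_lt (by fun_prop) (by fun_prop)).inter
        (isOpen_lt (by fun_prop) (by fun_prop))
    have hsub : {x : Eu d | ∀ i, 0 < x i ∧ x i < 1} ⊆ refElem d .cube :=
      fun x hx i => ⟨(hx i).1.le, (hx i).2.le⟩
    exact ⟨WithLp.toLp 2 fun _ => 2⁻¹, interior_maximal hsub hopen fun i => by norm_num⟩

theorem closure_interior_refElem (d : ℕ) (K : RefKind) :
    closure (interior (refElem d K)) = refElem d K := by
  rw [(convex_refElem d K).closure_interior_eq_closure_of_nonempty_interior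
    (interior_refElem_nonempty d K), (isCompact_refElem d K).isClosed.closure_eq]

/-- An outward normal of a facet of the reference element. It only vanishes for the facet
`∑ i, x i = 1` of the simplex in dimension `0`, which is empty. -/
def facetNormal (d : ℕ) : (K : RefKind) → FacetIdx d K → Eu d
  | .simplex, none => WithLp.toLp 2 1
  | .simplex, some i => -EuclideanSpace.single i 1
  | .cube, (i, false) => -EuclideanSpace.single i 1
  | .cube, (i, true) => EuclideanSpace.single i 1

/-- The value of the linear functional `⟪facetNormal d K k, ·⟫` on the facet `k`. -/
def facetLevel (d : ℕ) : (K : RefKind) → FacetIdx d K → ℝ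
  | .simplex, none => 1
  | .simplex, some _ => 0
  | .cube, (_, false) => 0
  | .cube, (_, true) => 1

theorem facetLevel_ne_zero_of_facetNormal_eq_zero {k : FacetIdx d K}
    (hk : facetNormal d K k = 0) : facetLevel d K k ≠ 0 := by
  match K, k with
  | .simplex, none => simp [facetLevel]
  | .simplex, some i => simp [facetNormal] at hk
  | .cube, (i, false) => simp [facetNormal] at hk
  | .cube, (i, true) => simp [facetNormal] at hk

theorem inner_facetNormal_le (k : FacetIdx d K) {x : Eu d} (hx : x ∈ refElem d K) :
    inner ℝ (facetNormal d K k) x ≤ facetLevel d K k := by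
  match K, k with
  | .simplex, none => simpa [facetNormal, facetLevel, PiLp.inner_apply] using hx.2
  | .simplex, some i =>
    simpa [facetNormal, facetLevel, EuclideanSpace.inner_single_left] using hx.1 i
  | .cube, (i, false) =>
    simpa [facetNormal, facetLevel, EuclideanSpace.inner_single_left] using (hx i).1
  | .cube, (i, true) =>
    simpa [facetNormal, facetLevel, EuclideanSpace.inner_single_left] using (hx i).2

theorem refFacet_eq (k : FacetIdx d K) :
    refFacet d K k =
      refElem d K ∩ {x | inner ℝ (facetNormal d K k) x = facetLevel d K k} := by
  ext x
  match K, k with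
  | .simplex, none => simp [refFacet, facetNormal, facetLevel, PiLp.inner_apply]
  | .simplex, some i =>
    simp [refFacet, facetNormal, facetLevel, EuclideanSpace.inner_single_left]
  | .cube, (i, false) =>
    simp [refFacet, facetNormal, facetLevel, EuclideanSpace.inner_single_left]
  | .cube, (i, true) =>
    simp [refFacet, facetNormal, facetLevel, EuclideanSpace.inner_single_left]

theorem refFacet_subset (k : FacetIdx d K) : refFacet d K k ⊆ refElem d K :=
  (refFacet_eq k).trans_subset inter_subset_left

theorem isCompact_refFacet (k : FacetIdx d K) : IsCompact (refFacet d K k) := by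
  rw [refFacet_eq]
  exact (isCompact_refElem d K).inter_right (isClosed_eq (by fun_prop) (by fun_prop))

theorem inner_facetNormal_eq {k : FacetIdx d K} {x : Eu d} (hx : x ∈ refFacet d K k) :
    inner ℝ (facetNormal d K k) x = facetLevel d K k := by
  rw [refFacet_eq] at hx
  exact hx.2

theorem facetNormal_ne_zero {k : FacetIdx d K} (hk : (refFacet d K k).Nonempty) :
    facetNormal d K k ≠ 0 := by
  obtain ⟨x, hx⟩ := hk
  intro h0
  refine facetLevel_ne_zero_of_facetNormal_eq_zero h0 ?_
  rw [← inner_facetNormal_eq hx, h0, inner_zero_left]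

theorem disjoint_interior_refFacet (k : FacetIdx d K) :
    Disjoint (interior (refElem d K)) (refFacet d K k) := by
  rw [Set.disjoint_left]
  intro x hx hxk
  set n := facetNormal d K k
  have hline : Tendsto (fun t : ℝ => x + t • n) (𝓝[>] 0) (𝓝 x) :=
    (Continuous.tendsto' (by fun_prop) 0 x (by simp)).mono_left nhdsWithin_le_nhds
  obtain ⟨t, ht, ht0⟩ := ((hline.eventually (mem_interior_iff_mem_nhds.1 hx)).and
    self_mem_nhdsWithin).exists
  have hle := inner_facetNormal_le k ht
  rw [inner_add_right, inner_smul_right, inner_facetNormal_eq hxk,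
    real_inner_self_eq_norm_sq] at hle
  have : 0 < t * ‖n‖ ^ 2 := mul_pos ht0 (pow_pos (norm_pos_iff.2 (facetNormal_ne_zero ⟨x, hxk⟩)) 2)
  linarith

theorem euclideanHausdorffMeasure_refFacet_lt_top (k : FacetIdx d K) :
    μHE[d - 1] (refFacet d K k) < ⊤ := by
  rcases (refFacet d K k).eq_empty_or_nonempty with hempty | hne
  · simp [hempty]
  · exact euclideanHausdorffMeasure_hyperplane_lt_top (isCompact_refFacet k).isBounded
      (facetNormal_ne_zero hne) fun _ hx => inner_facetNormal_eq hx

theorem contDiff_evalAt {n : WithTop ℕ∞} (q : MvPolynomial (Fin d) ℝ) :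
    ContDiff ℝ n fun x : Eu d => evalAt x q := by
  unfold evalAt
  induction q using MvPolynomial.induction_on with
  | C r => simpa using contDiff_const
  | add p q hp hq => simpa using hp.add hq
  | mul_X p i hp =>
    simp only [map_mul, MvPolynomial.eval_X]
    exact hp.mul (by fun_prop)

theorem finiteDimensional_restrictDegree (d p : ℕ) :
    FiniteDimensional ℝ (MvPolynomial.restrictDegree (Fin d) ℝ p) := by
  have hfin : {m : Fin d →₀ ℕ | ∀ i, m i ≤ p}.Finite :=
    (Set.finite_Iic (fun _ : Fin d => p)).of_injOn (f := fun m : Fin d →₀ ℕ => ⇑m)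
      (fun _ hm => hm) DFunLike.coe_injective.injOn
  have := hfin.to_subtype
  exact (MvPolynomial.basisRestrictSupport ℝ _).finiteDimensional_of_finite

theorem finiteDimensional_refPoly (d : ℕ) (K : RefKind) (p : ℕ) :
    FiniteDimensional ℝ (refPoly d K p) := by
  have := finiteDimensional_restrictDegree d p
  cases K with
  | simplex =>
    exact Submodule.finiteDimensional_of_le
      (MvPolynomial.restrictTotalDegree_le_restrictDegree (Fin d) ℝ p)
  | cube => exact this

/-- The derivatives of polynomials, as continuous functions on the reference element. -/
def refDeriv (d : ℕ) (K : RefKind) :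
    MvPolynomial (Fin d) ℝ →ₗ[ℝ] C(refElem d K, Eu d →L[ℝ] ℝ) where
  toFun q := ⟨fun x => fderiv ℝ (fun y : Eu d => evalAt y q) x,
    ((contDiff_evalAt (n := 1) q).continuous_fderiv one_ne_zero).comp continuous_subtype_val⟩
  map_add' p q := by
    ext1 x
    have hp := (contDiff_evalAt (n := 1) p).differentiable one_ne_zero (x : Eu d)
    have hq := (contDiff_evalAt (n := 1) q).differentiable one_ne_zero (x : Eu d)
    simpa [evalAt] using fderiv_fun_add hp hq
  map_smul' c q := by
    ext1 x
    have hq := (contDiff_evalAt (n := 1) q).differentiable one_ne_zero (x : Eu d)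
    simpa [evalAt] using fderiv_fun_const_smul hq c

theorem exists_norm_fderiv_sq_le (d : ℕ) (K : RefKind) (p : ℕ) : ∃ C : ℝ, 0 ≤ C ∧
    ∀ q ∈ refPoly d K p, ∀ x ∈ refElem d K, ‖fderiv ℝ (fun y : Eu d => evalAt y q) x‖ ^ 2 ≤
      C * ∫ x in interior (refElem d K), ‖fderiv ℝ (fun y : Eu d => evalAt y q) x‖ ^ 2 := by
  have hK := isCompact_refElem d K
  have : CompactSpace (refElem d K) := isCompact_iff_compactSpace.1 hK
  have := finiteDimensional_refPoly d K p
  have := isOpenPosMeasure_comap_subtype (μ := (volume : Measure (Eu d))) hK.measurableSet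
    (closure_interior_refElem d K).ge
  have : IsFiniteMeasure ((volume : Measure (Eu d)).comap (Subtype.val : refElem d K → Eu d)) :=
    ⟨by simpa [comap_subtype_coe_apply hK.measurableSet] using hK.measure_lt_top⟩
  obtain ⟨C, hC, h⟩ := exists_norm_sq_le_integral
    ((volume : Measure (Eu d)).comap Subtype.val) ((refPoly d K p).map (refDeriv d K))
  refine ⟨C, hC, fun q hq x hx => ?_⟩
  have hint : ∫ x in interior (refElem d K), ‖fderiv ℝ (fun y : Eu d => evalAt y q) x‖ ^ 2 =
      ∫ x : refElem d K, ‖refDeriv d K q x‖ ^ 2 ∂(volume.comap Subtype.val) := by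
    rw [setIntegral_congr_set (interior_ae_eq_of_null_frontier
      ((convex_refElem d K).addHaar_frontier volume))]
    exact (integral_subtype_comap hK.measurableSet
      (fun x => ‖fderiv ℝ (fun y : Eu d => evalAt y q) x‖ ^ 2)).symm
  rw [hint]
  refine le_trans ?_ (h _ (Submodule.mem_map_of_mem hq))
  gcongr
  exact (refDeriv d K q).norm_coe_le_norm ⟨x, hx⟩

end RefElem

namespace Mesh

variable {d : ℕ} {K : RefKind} {Ω : Set (Eu d)} {κ : ℝ}

section Geometry

variable (M : Mesh K Ω)

theorem contDiff_map {n : WithTop ℕ∞} (T : Fin M.card) : ContDiff ℝ n (M.map T) := by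
  rw [contDiff_euclidean]
  intro i
  obtain ⟨q, -, hq⟩ := M.map_poly T i
  simp only [hq]
  exact contDiff_evalAt q

theorem continuous_map (T : Fin M.card) : Continuous (M.map T) :=
  (M.contDiff_map (n := 0) T).continuous

theorem isCompact_elem (T : Fin M.card) : IsCompact (M.elem T) :=
  (isCompact_refElem d K).image (M.continuous_map T)

theorem cell_subset_elem (T : Fin M.card) : M.cell T ⊆ M.elem T := image_mono interior_subset

theorem elem_subset_closure_cell (T : Fin M.card) : M.elem T ⊆ closure (M.cell T) := by
  rw [elem, ← closure_interior_refElem]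
  exact image_closure_subset_closure_image (M.continuous_map T)

theorem facet_subset_elem (T : Fin M.card) (k : FacetIdx d K) : M.facet T k ⊆ M.elem T :=
  image_mono (refFacet_subset k)

theorem isCompact_facet (T : Fin M.card) (k : FacetIdx d K) : IsCompact (M.facet T k) :=
  (isCompact_refFacet k).image (M.continuous_map T)

theorem pairwise_disjoint_cell : Pairwise (Function.onFun Disjoint M.cell) := by
  intro T T' h
  obtain ⟨I, J, ⟨k, hk⟩, -, hI, -⟩ := M.regular T T' h
  refine Set.disjoint_left.2 fun y hy hy' => ?_
  have hmem : y ∈ M.map T '' refElem d K ∩ M.map T' '' refElem d K :=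
    ⟨M.cell_subset_elem T hy, M.cell_subset_elem T' hy'⟩
  rw [hI] at hmem
  obtain ⟨x, hx, rfl⟩ := hmem
  obtain ⟨z, hz, hzx⟩ := hy
  have hxk : x ∈ refFacet d K k := mem_iInter₂.1 hx k hk
  obtain rfl := M.map_inj T (interior_subset hz) (refFacet_subset k hxk) hzx
  exact Set.disjoint_left.1 (disjoint_interior_refFacet k) hz hxk

variable {M} {e : Set (Eu d)}

theorem exists_facet_of_mem_faces (he : e ∈ M.faces) : ∃ T k, M.facet T k = e := by
  obtain ⟨p, -, hp⟩ := Finset.mem_image.1 he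
  exact ⟨p.1, p.2, hp⟩

theorem exists_facet_minus (he : e ∈ M.faces) : ∃ k, M.facet (M.minus e) k = e := by
  obtain ⟨T, k, rfl⟩ := exists_facet_of_mem_faces he
  exact (M.minus_spec T k).1

theorem norm_normal (he : e ∈ M.faces) : ‖M.normal e‖ = 1 := by
  obtain ⟨T, k, rfl⟩ := exists_facet_of_mem_faces he
  exact (M.minus_spec T k).2.1

theorem IsInterior.exists_facet_plus (he : M.IsInterior e) : ∃ k, M.facet (M.plus e) k = e := by
  obtain ⟨T, k, T', k', hne, rfl, h⟩ := he
  exact (M.plus_spec T k T' k' hne h.symm).2.1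

theorem subset_elem_minus (he : e ∈ M.faces) : e ⊆ M.elem (M.minus e) := by
  obtain ⟨k, hk⟩ := exists_facet_minus he
  exact hk.symm.trans_subset (M.facet_subset_elem _ k)

theorem IsInterior.subset_elem_plus (he : M.IsInterior e) : e ⊆ M.elem (M.plus e) := by
  obtain ⟨k, hk⟩ := he.exists_facet_plus
  exact hk.symm.trans_subset (M.facet_subset_elem _ k)

theorem isCompact_of_mem_faces (he : e ∈ M.faces) : IsCompact e := by
  obtain ⟨T, k, rfl⟩ := exists_facet_of_mem_faces he
  exact M.isCompact_facet T k

end Geometry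

section ShapeRegular

variable {M : Mesh K Ω}

theorem ShapeRegular.isChart_map (hM : M.ShapeRegular κ) (T : Fin M.card) :
    IsChart (M.map T) (refElem d K) (κ / Metric.diam (M.elem T)).toNNReal where
  contDiff := M.contDiff_map T
  subset_closure_interior := (closure_interior_refElem d K).ge
  antilipschitz := by
    refine AntilipschitzWith.of_le_mul_dist fun ⟨x, hx⟩ ⟨y, hy⟩ => ?_
    change dist x y ≤ _ * dist (M.map T x) (M.map T y)
    have hdist : dist (M.map T x) (M.map T y) ≤ Metric.diam (M.elem T) :=
      Metric.dist_le_diam_of_mem (M.isCompact_elem T).isBounded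
        (mem_image_of_mem _ hx) (mem_image_of_mem _ hy)
    rcases (Metric.diam_nonneg (s := M.elem T)).eq_or_lt with hdiam | hdiam
    · obtain rfl : x = y := M.map_inj T hx hy (dist_le_zero.1 (hdist.trans_eq hdiam.symm))
      simp only [dist_self, mul_zero, le_refl]
    · refine le_trans ?_ (mul_le_mul_of_nonneg_right (Real.le_coe_toNNReal _) dist_nonneg)
      rw [div_mul_eq_mul_div, le_div_iff₀' hdiam]
      exact (hM T x hx y hy).1

theorem ShapeRegular.lipschitzOnWith_map (hM : M.ShapeRegular κ) (T : Fin M.card) :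
    LipschitzOnWith (κ * Metric.diam (M.elem T)).toNNReal (M.map T) (refElem d K) :=
  LipschitzOnWith.of_dist_le' fun x hx y hy => (hM T x hx y hy).2

theorem ShapeRegular.isOpen_cell (hM : M.ShapeRegular κ) (T : Fin M.card) : IsOpen (M.cell T) :=
  (hM.isChart_map T).isOpen_image_interior

theorem ShapeRegular.euclideanHausdorffMeasure_facet_le (hM : M.ShapeRegular κ)
    (T : Fin M.card) (k : FacetIdx d K) (m : ℕ) :
    μHE[m] (M.facet T k) ≤
      ((κ * Metric.diam (M.elem T)).toNNReal : ENNReal) ^ m * μHE[m] (refFacet d K k) :=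
  euclideanHausdorffMeasure_image_le ((hM.lipschitzOnWith_map T).mono (refFacet_subset k)) m

theorem ShapeRegular.euclideanHausdorffMeasure_face_lt_top (hM : M.ShapeRegular κ)
    {e : Set (Eu d)} (he : e ∈ M.faces) : μHE[d - 1] e < ⊤ := by
  obtain ⟨T, k, rfl⟩ := exists_facet_of_mem_faces he
  exact (hM.euclideanHausdorffMeasure_facet_le T k _).trans_lt <| ENNReal.mul_lt_top
    (ENNReal.pow_lt_top ENNReal.coe_lt_top) (euclideanHausdorffMeasure_refFacet_lt_top k)

end ShapeRegular

/-! ### Traces -/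

/-- The function `w` on the open element `T` extends continuously to the closed element, so that
`Mesh.traceFrom` is this extension and not a junk value. -/
def HasContExt {X : Type} [TopologicalSpace X] (M : Mesh K Ω) (T : Fin M.card) (w : Eu d → X) :
    Prop :=
  ∃ W : Eu d → X, ContinuousOn W (M.elem T) ∧ EqOn w W (M.cell T)

section HasContExt

variable {M : Mesh K Ω} {T : Fin M.card} {X Y Z : Type} [TopologicalSpace X] [T2Space X]
  [TopologicalSpace Y] [T2Space Y] [TopologicalSpace Z] {w : Eu d → X} {z : Eu d → Y}

theorem traceFrom_eqOn {W : Eu d → X} (hW : ContinuousOn W (M.elem T)) (h : EqOn w W (M.cell T)) :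
    EqOn (M.traceFrom T w) W (M.elem T) := by
  intro x hx
  refine extendFrom_eq (M.elem_subset_closure_cell T hx) ?_
  refine ((hW x hx).mono_left (nhdsWithin_mono x (M.cell_subset_elem T))).congr' ?_
  filter_upwards [self_mem_nhdsWithin] with y hy using (h hy).symm

theorem HasContExt.traceFrom_eqOn_cell (h : M.HasContExt T w) :
    EqOn (M.traceFrom T w) w (M.cell T) := by
  obtain ⟨W, hW, hwW⟩ := h
  exact fun x hx => (traceFrom_eqOn hW hwW (M.cell_subset_elem T hx)).trans (hwW hx).symm

theorem HasContExt.continuousOn_traceFrom (h : M.HasContExt T w) :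
    ContinuousOn (M.traceFrom T w) (M.elem T) := by
  obtain ⟨W, hW, hwW⟩ := h
  exact hW.congr (traceFrom_eqOn hW hwW)

theorem HasContExt.comp₂ {f : X → Y → Z} (hf : Continuous (Function.uncurry f))
    (hw : M.HasContExt T w) (hz : M.HasContExt T z) : M.HasContExt T fun y => f (w y) (z y) :=
  ⟨fun y => f (M.traceFrom T w y) (M.traceFrom T z y),
    hf.comp_continuousOn (hw.continuousOn_traceFrom.prodMk hz.continuousOn_traceFrom),
    fun y hy => by simp only [hw.traceFrom_eqOn_cell hy, hz.traceFrom_eqOn_cell hy]⟩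

theorem HasContExt.traceFrom_comp₂ [T2Space Z] {f : X → Y → Z}
    (hf : Continuous (Function.uncurry f)) (hw : M.HasContExt T w) (hz : M.HasContExt T z)
    {x : Eu d} (hx : x ∈ M.elem T) :
    M.traceFrom T (fun y => f (w y) (z y)) x = f (M.traceFrom T w x) (M.traceFrom T z x) :=
  traceFrom_eqOn (W := fun y => f (M.traceFrom T w y) (M.traceFrom T z y))
    (hf.comp_continuousOn (hw.continuousOn_traceFrom.prodMk hz.continuousOn_traceFrom))
    (fun y hy => by simp only [hw.traceFrom_eqOn_cell hy, hz.traceFrom_eqOn_cell hy]) hx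

theorem HasContExt.integrableOn_cell {w : Eu d → ℝ} (hT : MeasurableSet (M.cell T))
    (h : M.HasContExt T w) : IntegrableOn w (M.cell T) := by
  obtain ⟨W, hW, hwW⟩ := h
  exact ((hW.integrableOn_compact (M.isCompact_elem T)).mono_set
    (M.cell_subset_elem T)).congr_fun hwW.symm hT

end HasContExt

/-! ### Piecewise polynomials -/

section PiecewisePoly

variable {M : Mesh K Ω} {p : ℕ} {v w : Eu d → ℝ} {T : Fin M.card} {q : MvPolynomial (Fin d) ℝ}

theorem hasContExt_of_mem_space (hM : M.ShapeRegular κ) (hv : v ∈ M.space p) (T : Fin M.card) :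
    M.HasContExt T v := by
  obtain ⟨q, -, hq⟩ := hv T
  refine ⟨fun y => evalAt (Function.invFunOn (M.map T) (refElem d K) y) q, ?_, ?_⟩
  · exact (contDiff_evalAt (n := 0) q).continuous.comp_continuousOn
      (lipschitzOnWith_invFunOn (hM.isChart_map T).antilipschitz).continuousOn
  · rintro _ ⟨x, hx, rfl⟩
    simp only [hq x hx, (M.map_inj T).leftInvOn_invFunOn (interior_subset hx)]

/-- The gradient, on the closed element `T`, of the function that is given on the reference element
by the polynomial `q`. -/
def localGrad (M : Mesh K Ω) (T : Fin M.card) (q : MvPolynomial (Fin d) ℝ) (y : Eu d) : Eu d :=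
  (InnerProductSpace.toDual ℝ (Eu d)).symm
    (pulledDeriv (M.map T) (refElem d K) (fun x => evalAt x q) y)

theorem norm_localGrad (T : Fin M.card) (q : MvPolynomial (Fin d) ℝ) (y : Eu d) :
    ‖M.localGrad T q y‖ = ‖pulledDeriv (M.map T) (refElem d K) (fun x => evalAt x q) y‖ :=
  LinearIsometryEquiv.norm_map _ _

theorem continuousOn_localGrad (hM : M.ShapeRegular κ) (T : Fin M.card)
    (q : MvPolynomial (Fin d) ℝ) : ContinuousOn (M.localGrad T q) (M.elem T) :=
  (InnerProductSpace.toDual ℝ (Eu d)).symm.continuous.comp_continuousOn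
    ((hM.isChart_map T).continuousOn_pulledDeriv (contDiff_evalAt q))

theorem hasGradientAt_localGrad (hM : M.ShapeRegular κ)
    (hq : ∀ x ∈ interior (refElem d K), v (M.map T x) = evalAt x q) {y : Eu d}
    (hy : y ∈ M.cell T) : HasGradientAt v (M.localGrad T q y) y := by
  rw [hasGradientAt_iff_hasFDerivAt, localGrad, LinearIsometryEquiv.apply_symm_apply]
  exact (hM.isChart_map T).hasFDerivAt_of_comp_eq (contDiff_evalAt q) hq hy

theorem brokenGrad_eqOn_cell (hM : M.ShapeRegular κ)
    (hq : ∀ x ∈ interior (refElem d K), v (M.map T x) = evalAt x q) :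
    EqOn (M.brokenGrad v) (M.localGrad T q) (M.cell T) := by
  intro y hy
  rw [brokenGrad, if_pos (mem_iUnion.2 ⟨T, hy⟩)]
  exact (hasGradientAt_localGrad hM hq hy).gradient

theorem hasContExt_brokenGrad (hM : M.ShapeRegular κ) (hv : v ∈ M.space p) (T : Fin M.card) :
    M.HasContExt T (M.brokenGrad v) := by
  obtain ⟨q, -, hq⟩ := hv T
  exact ⟨_, continuousOn_localGrad hM T q, brokenGrad_eqOn_cell hM hq⟩

theorem brokenGrad_sub (hM : M.ShapeRegular κ) (hv : v ∈ M.space p) (hw : w ∈ M.space p)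
    (y : Eu d) : M.brokenGrad (v - w) y = M.brokenGrad v y - M.brokenGrad w y := by
  by_cases hy : y ∈ ⋃ T, M.cell T
  · obtain ⟨T, hT⟩ := mem_iUnion.1 hy
    obtain ⟨q, -, hq⟩ := hv T
    obtain ⟨r, -, hr⟩ := hw T
    have hvq := hasGradientAt_localGrad hM hq hT
    have hwr := hasGradientAt_localGrad hM hr hT
    simp only [brokenGrad, if_pos hy]
    rw [hvq.gradient, hwr.gradient]
    refine HasGradientAt.gradient ?_
    rw [hasGradientAt_iff_hasFDerivAt] at hvq hwr ⊢
    rw [map_sub]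
    exact hvq.sub hwr
  · simp only [brokenGrad, if_neg hy, sub_zero]

end PiecewisePoly

variable {ΓD : Set (Eu d)} {M : Mesh K Ω} {p : ℕ} {A : Eu d → Eu d →L[ℝ] Eu d} {α β : ℝ}
  {e : Set (Eu d)} {u v w : Eu d → ℝ} {T : Fin M.card}

/-! ### Jumps and fluxes -/

section Faces

theorem mem_faces_of_mem_dgFaces (he : e ∈ M.dgFaces ΓD) : e ∈ M.faces := by
  classical exact (Finset.mem_filter.1 he).1

theorem hasContExt_flux (hM : M.ShapeRegular κ) (hA : M.HasContExt T A) (hv : v ∈ M.space p) :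
    M.HasContExt T fun y => A y (M.brokenGrad v y) :=
  hA.comp₂ isBoundedBilinearMap_apply.continuous (hasContExt_brokenGrad hM hv T)

theorem traceFrom_flux (hM : M.ShapeRegular κ) (hA : M.HasContExt T A) (hv : v ∈ M.space p)
    {x : Eu d} (hx : x ∈ M.elem T) :
    M.traceFrom T (fun y => A y (M.brokenGrad v y)) x =
      M.traceFrom T A x (M.traceFrom T (M.brokenGrad v) x) :=
  hA.traceFrom_comp₂ isBoundedBilinearMap_apply.continuous (hasContExt_brokenGrad hM hv T) hx

theorem traceFrom_sub (hM : M.ShapeRegular κ) (hu : u ∈ M.space p) (hv : v ∈ M.space p)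
    {x : Eu d} (hx : x ∈ M.elem T) :
    M.traceFrom T (u - v) x = M.traceFrom T u x - M.traceFrom T v x :=
  (hasContExt_of_mem_space hM hu T).traceFrom_comp₂ continuous_sub
    (hasContExt_of_mem_space hM hv T) hx

theorem traceFrom_flux_sub (hM : M.ShapeRegular κ) (hA : M.HasContExt T A)
    (hu : u ∈ M.space p) (hv : v ∈ M.space p) {x : Eu d} (hx : x ∈ M.elem T) :
    M.traceFrom T (fun y => A y (M.brokenGrad (u - v) y)) x =
      M.traceFrom T (fun y => A y (M.brokenGrad u y)) x -
        M.traceFrom T (fun y => A y (M.brokenGrad v y)) x := by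
  simp only [brokenGrad_sub hM hu hv, map_sub]
  exact (hasContExt_flux hM hA hu).traceFrom_comp₂ continuous_sub (hasContExt_flux hM hA hv) hx

theorem jump_sub (hM : M.ShapeRegular κ) (he : e ∈ M.faces) (hu : u ∈ M.space p)
    (hv : v ∈ M.space p) {x : Eu d} (hx : x ∈ e) :
    M.jump (u - v) e x = M.jump u e x - M.jump v e x := by
  by_cases hi : M.IsInterior e
  · simp only [jump, if_pos hi, traceFrom_sub hM hu hv (subset_elem_minus he hx),
      traceFrom_sub hM hu hv (hi.subset_elem_plus hx)]
    ring
  · simp only [jump, if_neg hi, traceFrom_sub hM hu hv (subset_elem_minus he hx)]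

theorem avgFlux_sub (hM : M.ShapeRegular κ) (hA : ∀ T, M.HasContExt T A) (he : e ∈ M.faces)
    (hu : u ∈ M.space p) (hv : v ∈ M.space p) {x : Eu d} (hx : x ∈ e) :
    M.avgFlux A (u - v) e x = M.avgFlux A u e x - M.avgFlux A v e x := by
  by_cases hi : M.IsInterior e
  · simp only [avgFlux, if_pos hi, inner_sub_right,
      traceFrom_flux_sub hM (hA _) hu hv (subset_elem_minus he hx),
      traceFrom_flux_sub hM (hA _) hu hv (hi.subset_elem_plus hx)]
    ring
  · simp only [avgFlux, if_neg hi, inner_sub_right,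
      traceFrom_flux_sub hM (hA _) hu hv (subset_elem_minus he hx)]

theorem continuousOn_jump (hM : M.ShapeRegular κ) (he : e ∈ M.faces) (hv : v ∈ M.space p) :
    ContinuousOn (M.jump v e) e := by
  have htrace T : ContinuousOn (M.traceFrom T v) (M.elem T) :=
    (hasContExt_of_mem_space hM hv T).continuousOn_traceFrom
  unfold jump
  split_ifs with hi
  · exact ((htrace _).mono (subset_elem_minus he)).sub ((htrace _).mono hi.subset_elem_plus)
  · exact (htrace _).mono (subset_elem_minus he)

theorem continuousOn_avgFlux (hM : M.ShapeRegular κ) (hA : ∀ T, M.HasContExt T A)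
    (he : e ∈ M.faces) (hv : v ∈ M.space p) : ContinuousOn (M.avgFlux A v e) e := by
  have htrace T : ContinuousOn (fun x => (inner ℝ (M.normal e)
      (M.traceFrom T (fun y => A y (M.brokenGrad v y)) x) : ℝ)) (M.elem T) :=
    continuousOn_const.inner (𝕜 := ℝ) (hasContExt_flux hM (hA T) hv).continuousOn_traceFrom
  unfold avgFlux
  split_ifs with hi
  · exact (((htrace _).mono (subset_elem_minus he)).add
      ((htrace _).mono hi.subset_elem_plus)).div_const 2
  · exact (htrace _).mono (subset_elem_minus he)

theorem ShapeRegular.integrableOn_face (hM : M.ShapeRegular κ) (he : e ∈ M.faces) {f : Eu d → ℝ}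
    (hf : ContinuousOn f e) : IntegrableOn f e μHE[d - 1] := by
  have hcompact := isCompact_of_mem_faces he
  have : IsFiniteMeasure ((μHE[d - 1]).restrict e) :=
    isFiniteMeasure_restrict.2 (hM.euclideanHausdorffMeasure_face_lt_top he).ne
  have hint := hf.integrableOn_compact (μ := (μHE[d - 1]).restrict e) hcompact
  rwa [IntegrableOn, Measure.restrict_restrict hcompact.measurableSet, inter_self] at hint

theorem integrableOn_jump_mul_jump (hM : M.ShapeRegular κ) (he : e ∈ M.faces)
    (hu : u ∈ M.space p) (hv : v ∈ M.space p) :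
    IntegrableOn (fun x => M.jump u e x * M.jump v e x) e μHE[d - 1] :=
  hM.integrableOn_face he ((continuousOn_jump hM he hu).mul (continuousOn_jump hM he hv))

theorem integrableOn_avgFlux_mul_jump (hM : M.ShapeRegular κ) (hA : ∀ T, M.HasContExt T A)
    (he : e ∈ M.faces) (hu : u ∈ M.space p) (hv : v ∈ M.space p) :
    IntegrableOn (fun x => M.avgFlux A u e x * M.jump v e x) e μHE[d - 1] :=
  hM.integrableOn_face he ((continuousOn_avgFlux hM hA he hu).mul (continuousOn_jump hM he hv))

end Faces

/-! ### Volume integrals -/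

section Volume

theorem ShapeRegular.integrableOn_of_hasContExt (hM : M.ShapeRegular κ) (hΩ : MeasurableSet Ω)
    {f : Eu d → ℝ} (hf : ∀ T, M.HasContExt T f) (hf₀ : ∀ x ∉ ⋃ T, M.cell T, f x = 0) :
    IntegrableOn f Ω :=
  IntegrableOn.of_forall_sdiff_eq_zero (s := ⋃ T, M.cell T)
    (integrableOn_finite_iUnion.2 fun T =>
      (hf T).integrableOn_cell (hM.isOpen_cell T).measurableSet)
    hΩ fun x hx => hf₀ x hx.2

theorem ShapeRegular.setIntegral_eq_sum_cell (hM : M.ShapeRegular κ) (hΩ : MeasurableSet Ω)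
    {f : Eu d → ℝ} (hf : ∀ T, M.HasContExt T f) (hf₀ : ∀ x ∉ ⋃ T, M.cell T, f x = 0) :
    ∫ x in Ω, f x = ∑ T, ∫ x in M.cell T, f x := by
  have hmeas T : MeasurableSet (M.cell T) := (hM.isOpen_cell T).measurableSet
  rw [← integral_iUnion_fintype hmeas M.pairwise_disjoint_cell
    fun T => (hf T).integrableOn_cell (hmeas T)]
  exact setIntegral_eq_of_subset_of_forall_sdiff_eq_zero
    hΩ (iUnion_subset M.subset) fun x hx => hf₀ x hx.2

theorem brokenGrad_of_notMem (v : Eu d → ℝ) {x : Eu d} (hx : x ∉ ⋃ T, M.cell T) :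
    M.brokenGrad v x = 0 := if_neg hx

theorem hasContExt_norm_sq_brokenGrad (hM : M.ShapeRegular κ) (hv : v ∈ M.space p)
    (T : Fin M.card) : M.HasContExt T fun x => ‖M.brokenGrad v x‖ ^ 2 :=
  (hasContExt_brokenGrad hM hv T).comp₂ (f := fun ξ _ => ‖ξ‖ ^ 2) (by fun_prop)
    (hasContExt_brokenGrad hM hv T)

theorem integrableOn_inner_flux (hM : M.ShapeRegular κ) (hΩ : MeasurableSet Ω)
    (hA : ∀ T, M.HasContExt T A) (hu : u ∈ M.space p) (hv : v ∈ M.space p) :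
    IntegrableOn (fun x => (inner ℝ (A x (M.brokenGrad u x)) (M.brokenGrad v x) : ℝ)) Ω := by
  refine hM.integrableOn_of_hasContExt hΩ (fun T => ?_) fun x hx => ?_
  · exact (hasContExt_flux hM (hA T) hu).comp₂ continuous_inner (hasContExt_brokenGrad hM hv T)
  · rw [brokenGrad_of_notMem v hx, inner_zero_right]

end Volume

/-! ### The three parts of the interior penalty form -/

section Form

/-- The volume part `(A∇_h u, ∇_h v)` of the interior penalty form. -/
def gradForm (M : Mesh K Ω) (A : Eu d → Eu d →L[ℝ] Eu d) (u v : Eu d → ℝ) : ℝ :=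
  ∫ x in Ω, inner ℝ (A x (M.brokenGrad u x)) (M.brokenGrad v x)

/-- The consistency part `∑_e ({ν · A∇u}, [v])_{L²(e)}` of the interior penalty form. -/
def fluxForm (M : Mesh K Ω) (ΓD : Set (Eu d)) (A : Eu d → Eu d →L[ℝ] Eu d) (u v : Eu d → ℝ) : ℝ :=
  ∑ e ∈ M.dgFaces ΓD, ∫ x in e, M.avgFlux A u e x * M.jump v e x ∂μHE[d - 1]

/-- The penalty part `∑_e σ / h_e ([u], [v])_{L²(e)}` of the interior penalty form. -/
def penaltyForm (M : Mesh K Ω) (ΓD : Set (Eu d)) (σ : ℝ) (u v : Eu d → ℝ) : ℝ :=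
  ∑ e ∈ M.dgFaces ΓD,
    σ / Metric.diam e * ∫ x in e, M.jump u e x * M.jump v e x ∂μHE[d - 1]

theorem form_eq (M : Mesh K Ω) (ΓD : Set (Eu d)) (A : Eu d → Eu d →L[ℝ] Eu d) (σ : ℝ)
    (u v : Eu d → ℝ) :
    M.form ΓD A σ u v = M.gradForm A u v -
      (M.fluxForm ΓD A u v + M.fluxForm ΓD A v u - M.penaltyForm ΓD σ u v) := by
  simp only [form, gradForm, fluxForm, penaltyForm, Finset.sum_sub_distrib, Finset.sum_add_distrib]

theorem energyNorm_eq (M : Mesh K Ω) (ΓD : Set (Eu d)) (A : Eu d → Eu d →L[ℝ] Eu d) (σ : ℝ)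
    (v : Eu d → ℝ) :
    M.energyNorm ΓD A σ v = Real.sqrt (M.gradForm A v v + M.penaltyForm ΓD σ v v) := by
  simp only [energyNorm, gradForm, penaltyForm, sq]

theorem gradForm_comm
    (hA : ∀ᵐ x ∂volume.restrict Ω, ∀ ξ η, inner ℝ (A x ξ) η = inner ℝ ξ (A x η))
    (u v : Eu d → ℝ) : M.gradForm A u v = M.gradForm A v u := by
  refine integral_congr_ae ?_
  filter_upwards [hA] with x hx
  rw [hx, real_inner_comm]

theorem penaltyForm_comm (M : Mesh K Ω) (ΓD : Set (Eu d)) (σ : ℝ) (u v : Eu d → ℝ) :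
    M.penaltyForm ΓD σ u v = M.penaltyForm ΓD σ v u := by
  simp only [penaltyForm, mul_comm (M.jump u _ _)]

theorem form_comm
    (hA : ∀ᵐ x ∂volume.restrict Ω, ∀ ξ η, inner ℝ (A x ξ) η = inner ℝ ξ (A x η))
    (ΓD : Set (Eu d)) (σ : ℝ) (u v : Eu d → ℝ) : M.form ΓD A σ u v = M.form ΓD A σ v u := by
  rw [form_eq, form_eq, gradForm_comm hA u v, penaltyForm_comm M ΓD σ u v,
    add_comm (M.fluxForm ΓD A u v)]

theorem gradForm_sub_left (hM : M.ShapeRegular κ) (hΩ : MeasurableSet Ω)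
    (hA : ∀ T, M.HasContExt T A) (hu : u ∈ M.space p) (hv : v ∈ M.space p) (hw : w ∈ M.space p) :
    M.gradForm A (u - v) w = M.gradForm A u w - M.gradForm A v w := by
  simp only [gradForm, brokenGrad_sub hM hu hv, map_sub, inner_sub_left]
  exact integral_sub (integrableOn_inner_flux hM hΩ hA hu hw)
    (integrableOn_inner_flux hM hΩ hA hv hw)

theorem fluxForm_sub_left (hM : M.ShapeRegular κ) (hA : ∀ T, M.HasContExt T A)
    (ΓD : Set (Eu d)) (hu : u ∈ M.space p) (hv : v ∈ M.space p) (hw : w ∈ M.space p) :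
    M.fluxForm ΓD A (u - v) w = M.fluxForm ΓD A u w - M.fluxForm ΓD A v w := by
  simp only [fluxForm, ← Finset.sum_sub_distrib]
  refine Finset.sum_congr rfl fun e he => ?_
  replace he := mem_faces_of_mem_dgFaces he
  rw [← integral_sub (integrableOn_avgFlux_mul_jump hM hA he hu hw)
    (integrableOn_avgFlux_mul_jump hM hA he hv hw)]
  refine setIntegral_congr_fun (isCompact_of_mem_faces he).measurableSet fun x hx => ?_
  simp only [avgFlux_sub hM hA he hu hv hx, sub_mul]

theorem fluxForm_sub_right (hM : M.ShapeRegular κ) (hA : ∀ T, M.HasContExt T A)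
    (ΓD : Set (Eu d)) (hu : u ∈ M.space p) (hv : v ∈ M.space p) (hw : w ∈ M.space p) :
    M.fluxForm ΓD A u (v - w) = M.fluxForm ΓD A u v - M.fluxForm ΓD A u w := by
  simp only [fluxForm, ← Finset.sum_sub_distrib]
  refine Finset.sum_congr rfl fun e he => ?_
  replace he := mem_faces_of_mem_dgFaces he
  rw [← integral_sub (integrableOn_avgFlux_mul_jump hM hA he hu hv)
    (integrableOn_avgFlux_mul_jump hM hA he hu hw)]
  refine setIntegral_congr_fun (isCompact_of_mem_faces he).measurableSet fun x hx => ?_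
  simp only [jump_sub hM he hv hw hx, mul_sub]

theorem penaltyForm_sub_left (hM : M.ShapeRegular κ) (ΓD : Set (Eu d)) (σ : ℝ)
    (hu : u ∈ M.space p) (hv : v ∈ M.space p) (hw : w ∈ M.space p) :
    M.penaltyForm ΓD σ (u - v) w = M.penaltyForm ΓD σ u w - M.penaltyForm ΓD σ v w := by
  simp only [penaltyForm, ← Finset.sum_sub_distrib, ← mul_sub]
  refine Finset.sum_congr rfl fun e he => congrArg (σ / Metric.diam e * ·) ?_
  replace he := mem_faces_of_mem_dgFaces he
  rw [← integral_sub (integrableOn_jump_mul_jump hM he hu hw)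
    (integrableOn_jump_mul_jump hM he hv hw)]
  refine setIntegral_congr_fun (isCompact_of_mem_faces he).measurableSet fun x hx => ?_
  simp only [jump_sub hM he hu hv hx, sub_mul]

theorem form_sub_left (hM : M.ShapeRegular κ) (hΩ : MeasurableSet Ω)
    (hA : ∀ T, M.HasContExt T A) (ΓD : Set (Eu d)) (σ : ℝ) (hu : u ∈ M.space p)
    (hv : v ∈ M.space p) (hw : w ∈ M.space p) :
    M.form ΓD A σ (u - v) w = M.form ΓD A σ u w - M.form ΓD A σ v w := by
  rw [form_eq, form_eq, form_eq, gradForm_sub_left hM hΩ hA hu hv hw,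
    fluxForm_sub_left hM hA ΓD hu hv hw, fluxForm_sub_right hM hA ΓD hw hu hv,
    penaltyForm_sub_left hM ΓD σ hu hv hw]
  ring

theorem form_sub_right (hM : M.ShapeRegular κ) (hΩ : MeasurableSet Ω)
    (hA : M.IsDiffusion A α β) (ΓD : Set (Eu d)) (σ : ℝ) (hu : u ∈ M.space p)
    (hv : v ∈ M.space p) (hw : w ∈ M.space p) :
    M.form ΓD A σ u (v - w) = M.form ΓD A σ u v - M.form ΓD A σ u w := by
  simp only [form_comm hA.symm ΓD σ u, form_sub_left hM hΩ hA.piecewise ΓD σ hv hw hu]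

end Form

end Mesh

section ChangeOfVariables

variable {X Y : Type*} [MetricSpace X] [MeasurableSpace X] [BorelSpace X] [MetricSpace Y]
  [MeasurableSpace Y] [BorelSpace Y] {F : X → Y} {s : Set X} {c : ℝ≥0} {f : Y → ℝ} {m : ℕ}

theorem integrable_map_restrict_of_integrableOn_image (hF : Measurable F)
    (hs : AntilipschitzWith c (s.domRestrict F)) (hf : IntegrableOn f (F '' s) μHE[m]) :
    Integrable f ((μHE[m].restrict s).map F) := by
  refine Integrable.mono_measure ?_ (map_restrict_euclideanHausdorffMeasure_le hF hs m)
  exact hf.smul_measure (ENNReal.pow_ne_top ENNReal.coe_ne_top)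

theorem setIntegral_comp_le_of_antilipschitz (hF : Measurable F)
    (hs : AntilipschitzWith c (s.domRestrict F)) (hf : IntegrableOn f (F '' s) μHE[m])
    (hf₀ : ∀ y, 0 ≤ f y) :
    ∫ x in s, f (F x) ∂μHE[m] ≤ c ^ m * ∫ y in F '' s, f y ∂μHE[m] := by
  have hmap := integrable_map_restrict_of_integrableOn_image hF hs hf
  calc ∫ x in s, f (F x) ∂μHE[m]
      = ∫ y, f y ∂((μHE[m].restrict s).map F) :=
        (integral_map hF.aemeasurable hmap.aestronglyMeasurable).symm
    _ ≤ ∫ y, f y ∂((c : ENNReal) ^ m • μHE[m].restrict (F '' s)) :=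
        integral_mono_measure (map_restrict_euclideanHausdorffMeasure_le hF hs m)
          (ae_of_all _ hf₀) (hf.smul_measure (ENNReal.pow_ne_top ENNReal.coe_ne_top))
    _ = c ^ m * ∫ y in F '' s, f y ∂μHE[m] := by
        rw [integral_smul_measure, ENNReal.toReal_pow, ENNReal.coe_toReal, smul_eq_mul]

end ChangeOfVariables

/-! ### The discrete trace inequality -/

theorem coe_toNNReal_le_abs (a : ℝ) : (a.toNNReal : ℝ) ≤ |a| := by
  rw [Real.coe_toNNReal']
  exact max_le (le_abs_self a) (abs_nonneg a)

theorem mul_toNNReal_div_le_abs (κ : ℝ) {h : ℝ} (hh : 0 ≤ h) : h * (κ / h).toNNReal ≤ |κ| := by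
  calc h * (κ / h).toNNReal ≤ h * |κ / h| := by gcongr; exact coe_toNNReal_le_abs _
    _ = |κ| * (h / h) := by rw [abs_div, abs_of_nonneg hh, mul_div_left_comm]
    _ ≤ |κ| := mul_le_of_le_one_right (abs_nonneg κ) (div_self_le_one h)

theorem toNNReal_mul_mul_toNNReal_div_le_sq (κ : ℝ) {h : ℝ} (hh : 0 ≤ h) :
    ((κ * h).toNNReal * (κ / h).toNNReal : ℝ) ≤ κ ^ 2 := by
  calc ((κ * h).toNNReal * (κ / h).toNNReal : ℝ)
      ≤ |κ * h| * (κ / h).toNNReal := by gcongr; exact coe_toNNReal_le_abs _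
    _ = |κ| * (h * (κ / h).toNNReal) := by rw [abs_mul, abs_of_nonneg hh, mul_assoc]
    _ ≤ |κ| * |κ| := by gcongr; exact mul_toNNReal_div_le_abs κ hh
    _ = κ ^ 2 := by rw [← sq, sq_abs]

namespace Mesh

variable {d : ℕ} {K : RefKind} {Ω : Set (Eu d)} {M : Mesh K Ω} {κ : ℝ} {p : ℕ} {v : Eu d → ℝ}

theorem setIntegral_norm_fderiv_sq_le (hM : M.ShapeRegular κ) (T : Fin M.card)
    (q : MvPolynomial (Fin d) ℝ) :
    ∫ x in interior (refElem d K), ‖fderiv ℝ (fun y : Eu d => evalAt y q) x‖ ^ 2 ≤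
      (κ * Metric.diam (M.elem T)).toNNReal ^ 2 *
        ((κ / Metric.diam (M.elem T)).toNNReal ^ d * ∫ y in M.cell T, ‖M.localGrad T q y‖ ^ 2) := by
  have hmeas : Measurable (M.map T) := (M.continuous_map T).measurable
  have hanti : AntilipschitzWith (κ / Metric.diam (M.elem T)).toNNReal
      ((interior (refElem d K)).domRestrict (M.map T)) := fun x y =>
    (hM.isChart_map T).antilipschitz ⟨x, interior_subset x.2⟩ ⟨y, interior_subset y.2⟩
  have hint : IntegrableOn (fun y => ‖M.localGrad T q y‖ ^ 2) (M.cell T) :=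
    HasContExt.integrableOn_cell (hM.isOpen_cell T).measurableSet
      ⟨_, (continuousOn_localGrad hM T q).norm.pow 2, fun _ _ => rfl⟩
  rw [← EuclideanSpace.euclideanHausdorffMeasure_eq_volume] at hint ⊢
  have hfderiv : Continuous fun x => ‖fderiv ℝ (fun y : Eu d => evalAt y q) x‖ ^ 2 :=
    ((contDiff_evalAt (n := 1) q).continuous_fderiv one_ne_zero).norm.pow 2
  have hcomp : IntegrableOn (fun x => ‖M.localGrad T q (M.map T x)‖ ^ 2)
      (interior (refElem d K)) μHE[d] :=
    (integrable_map_restrict_of_integrableOn_image hmeas hanti hint).comp_measurable hmeas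
  refine le_trans ?_ (mul_le_mul_of_nonneg_left
    (setIntegral_comp_le_of_antilipschitz hmeas hanti hint fun _ => sq_nonneg _) (by positivity))
  rw [← integral_const_mul]
  refine setIntegral_mono_on ?_ (hcomp.const_mul _) isOpen_interior.measurableSet fun x hx => ?_
  · rw [EuclideanSpace.euclideanHausdorffMeasure_eq_volume]
    exact (hfderiv.continuousOn.integrableOn_compact (isCompact_refElem d K)).mono_set
      interior_subset
  · rw [norm_localGrad, ← mul_pow, mul_comm]
    gcongr
    exact (hM.isChart_map T).norm_fderiv_le_mul_norm_pulledDeriv (hM.lipschitzOnWith_map T) hx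

theorem setIntegral_facet_norm_localGrad_sq_le (hM : M.ShapeRegular κ) (T : Fin M.card)
    (k : FacetIdx d K) {q : MvPolynomial (Fin d) ℝ} {S : ℝ}
    (hS : ∀ x ∈ refElem d K, ‖fderiv ℝ (fun y : Eu d => evalAt y q) x‖ ^ 2 ≤ S) (m : ℕ)
    (hk : μHE[m] (refFacet d K k) < ⊤) :
    ∫ x in M.facet T k, ‖M.localGrad T q x‖ ^ 2 ∂μHE[m] ≤
      S * (κ / Metric.diam (M.elem T)).toNNReal ^ 2 *
        ((κ * Metric.diam (M.elem T)).toNNReal ^ m * (μHE[m] (refFacet d K k)).toReal) := by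
  have hmeasure := hM.euclideanHausdorffMeasure_facet_le T k m
  have hfinite := ENNReal.mul_lt_top (ENNReal.pow_lt_top (n := m)
    (ENNReal.coe_lt_top (r := (κ * Metric.diam (M.elem T)).toNNReal))) hk
  have hpointwise : ∀ x ∈ M.facet T k, ‖‖M.localGrad T q x‖ ^ 2‖ ≤
      S * (κ / Metric.diam (M.elem T)).toNNReal ^ 2 := by
    intro x hx
    obtain ⟨z, hz, rfl⟩ := M.facet_subset_elem T k hx
    rw [Real.norm_of_nonneg (sq_nonneg _), norm_localGrad]
    refine (pow_le_pow_left₀ (norm_nonneg _) ((hM.isChart_map T).norm_pulledDeriv_le hz) 2).trans ?_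
    rw [mul_pow]
    gcongr
    exact hS z hz
  refine (le_abs_self _).trans ((norm_setIntegral_le_of_norm_le_const
    (hmeasure.trans_lt hfinite) hpointwise).trans ?_)
  obtain ⟨z, hz⟩ := (interior_refElem_nonempty d K).mono interior_subset
  have hS₀ : 0 ≤ S := (sq_nonneg _).trans (hS z hz)
  gcongr
  simpa only [Measure.real, ENNReal.toReal_mul, ENNReal.toReal_pow, ENNReal.coe_toReal]
    using ENNReal.toReal_mono hfinite.ne hmeasure

/-- The discrete trace inequality with constant `C`: on each element, the trace of the piecewise
gradient of a piecewise polynomial of degree `p` is controlled by the volume term, the diameter of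
the element having the exponent that makes the inequality invariant under dilations. -/
def TraceInequality (M : Mesh K Ω) (p : ℕ) (C : ℝ) : Prop :=
  ∀ v ∈ M.space p, ∀ T k,
    Metric.diam (M.elem T) *
        ∫ x in M.facet T k, ‖M.traceFrom T (M.brokenGrad v) x‖ ^ 2 ∂μHE[d - 1] ≤
      C * ∫ x in M.cell T, ‖M.brokenGrad v x‖ ^ 2

theorem exists_diam_mul_setIntegral_facet_le {d : ℕ} (hd : d ≠ 0) (K : RefKind) (p : ℕ) (κ : ℝ) :
    ∃ C, 0 ≤ C ∧ ∀ (Ω : Set (Eu d)) (M : Mesh K Ω), M.ShapeRegular κ → ∀ q ∈ refPoly d K p, ∀ T k,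
      Metric.diam (M.elem T) * ∫ x in M.facet T k, ‖M.localGrad T q x‖ ^ 2 ∂μHE[d - 1] ≤
        C * ∫ x in M.cell T, ‖M.localGrad T q x‖ ^ 2 := by
  obtain ⟨C, hC, hsup⟩ := exists_norm_fderiv_sq_le d K p
  set m : ℝ := ∑ k : FacetIdx d K, (μHE[d - 1] (refFacet d K k)).toReal
  have hm₀ : 0 ≤ m := Finset.sum_nonneg fun _ _ => ENNReal.toReal_nonneg
  refine ⟨|κ| * (κ ^ 2) ^ (d + 1) * (C * m), by positivity, fun Ω M hM q hq T k => ?_⟩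
  have hfacet := setIntegral_facet_norm_localGrad_sq_le hM T k (hsup q hq) (d - 1)
    (euclideanHausdorffMeasure_refFacet_lt_top k)
  have hvolume := setIntegral_norm_fderiv_sq_le hM T q
  have hmk : (μHE[d - 1] (refFacet d K k)).toReal ≤ m :=
    Finset.single_le_sum (f := fun k => (μHE[d - 1] (refFacet d K k)).toReal)
      (fun _ _ => ENNReal.toReal_nonneg) (Finset.mem_univ k)
  have hhc := mul_toNNReal_div_le_abs κ (Metric.diam_nonneg (s := M.elem T))
  have hbc := toNNReal_mul_mul_toNNReal_div_le_sq κ (Metric.diam_nonneg (s := M.elem T))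
  set h := Metric.diam (M.elem T)
  set b := (κ * h).toNNReal
  set c := (κ / h).toNNReal
  set I := ∫ x in interior (refElem d K), ‖fderiv ℝ (fun y : Eu d => evalAt y q) x‖ ^ 2
  set J := ∫ x in M.cell T, ‖M.localGrad T q x‖ ^ 2
  have hJ : 0 ≤ J := integral_nonneg fun _ => sq_nonneg _
  calc h * ∫ x in M.facet T k, ‖M.localGrad T q x‖ ^ 2 ∂μHE[d - 1]
      ≤ h * (C * (b ^ 2 * (c ^ d * J)) * c ^ 2 * (b ^ (d - 1) * m)) := by
        gcongr
        exact hfacet.trans (by gcongr)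
    _ = h * c * (b * c) ^ (d + 1) * (C * m) * J := by
        obtain ⟨n, rfl⟩ := Nat.exists_eq_succ_of_ne_zero hd
        simp only [Nat.succ_eq_add_one, Nat.add_sub_cancel]
        ring
    _ ≤ |κ| * (κ ^ 2) ^ (d + 1) * (C * m) * J := by gcongr

theorem exists_traceInequality {d : ℕ} (hd : d ≠ 0) (K : RefKind) (p : ℕ) (κ : ℝ) :
    ∃ C, 0 ≤ C ∧ ∀ (Ω : Set (Eu d)) (M : Mesh K Ω), M.ShapeRegular κ → M.TraceInequality p C := by
  obtain ⟨C, hC, hfacet⟩ := exists_diam_mul_setIntegral_facet_le hd K p κ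
  refine ⟨C, hC, fun Ω M hM v hv T k => ?_⟩
  obtain ⟨q, hqp, hq⟩ := hv T
  have hgrad := brokenGrad_eqOn_cell hM hq
  have htrace := traceFrom_eqOn (continuousOn_localGrad hM T q) hgrad
  rw [setIntegral_congr_fun (g := fun x => ‖M.localGrad T q x‖ ^ 2)
      (M.isCompact_facet T k).measurableSet fun x hx => by
        simp only [htrace (M.facet_subset_elem T k hx)],
    setIntegral_congr_fun (g := fun x => ‖M.localGrad T q x‖ ^ 2)
      (hM.isOpen_cell T).measurableSet fun x hx => by simp only [hgrad hx]]
  exact hfacet Ω M hM q hqp T k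

end Mesh

/-! ### Cauchy–Schwarz inequalities -/

section CauchySchwarz

theorem inner_apply_sq_le_of_isPositive {E : Type*} [NormedAddCommGroup E] [InnerProductSpace ℝ E]
    {B : E →L[ℝ] E} (hB : B.IsPositive) (v w : E) :
    (inner ℝ (B v) w : ℝ) ^ 2 ≤ inner ℝ (B v) v * inner ℝ (B w) w := by
  let b : LinearMap.BilinForm ℝ E := innerₗ E ∘ₗ (B : E →ₗ[ℝ] E)
  have hb : LinearMap.IsSymm b := ⟨fun x y => (hB.isSymmetric x y).trans (real_inner_comm _ _)⟩
  exact b.apply_sq_le_of_symm (fun x => hB.inner_nonneg_left x) hb v w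

theorem norm_le_of_isPositive_of_forall_inner_le {E : Type*} [NormedAddCommGroup E]
    [InnerProductSpace ℝ E] {B : E →L[ℝ] E} (hB : B.IsPositive) {β : ℝ} (hβ : 0 ≤ β)
    (hle : ∀ v, (inner ℝ (B v) v : ℝ) ≤ β * ‖v‖ ^ 2) : ‖B‖ ≤ β := by
  rw [B.norm_eq_iSup_rayleighQuotient hB.isSymmetric]
  refine Real.iSup_le (fun v => ?_) hβ
  have hnonneg : 0 ≤ B.rayleighQuotient v := div_nonneg (hB.inner_nonneg_left v) (sq_nonneg _)
  rw [abs_of_nonneg hnonneg]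
  exact div_le_of_le_mul₀ (sq_nonneg _) hβ (hle v)

theorem abs_integral_le_sqrt_mul_sqrt {X : Type*} [MeasurableSpace X] {μ : Measure X}
    {f g h : X → ℝ} (hg : Integrable g μ) (hh : Integrable h μ) (hg₀ : 0 ≤ᵐ[μ] g)
    (hh₀ : 0 ≤ᵐ[μ] h) (hf : ∀ᵐ x ∂μ, |f x| ≤ √(g x) * √(h x)) :
    |∫ x, f x ∂μ| ≤ √(∫ x, g x ∂μ) * √(∫ x, h x ∂μ) := by
  have memLp_sqrt {k : X → ℝ} (hk : Integrable k μ) (hk₀ : 0 ≤ᵐ[μ] k) :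
      MemLp (fun x => √(k x)) 2 μ := by
    rw [memLp_two_iff_integrable_sq
      (Real.continuous_sqrt.comp_aestronglyMeasurable hk.aestronglyMeasurable)]
    exact hk.congr (hk₀.mono fun x hx => (Real.sq_sqrt hx).symm)
  have integral_sqrt_sq {k : X → ℝ} (hk₀ : 0 ≤ᵐ[μ] k) :
      (∫ x, √(k x) ^ (2 : ℝ) ∂μ) ^ (1 / 2 : ℝ) = √(∫ x, k x ∂μ) := by
    rw [← Real.sqrt_eq_rpow]
    refine congrArg _ (integral_congr_ae (hk₀.mono fun x hx => ?_))
    simp only [Real.rpow_two]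
    exact Real.sq_sqrt hx
  have hg₂ := memLp_sqrt hg hg₀
  have hh₂ := memLp_sqrt hh hh₀
  have hoelder := integral_mul_le_Lp_mul_Lq_of_nonneg Real.HolderConjugate.two_two
    (μ := μ) (.of_forall fun x => Real.sqrt_nonneg (g x))
    (.of_forall fun x => Real.sqrt_nonneg (h x)) (by simpa using hg₂) (by simpa using hh₂)
  rw [integral_sqrt_sq hg₀, integral_sqrt_sq hh₀] at hoelder
  have hprod : Integrable (fun x => √(g x) * √(h x)) μ := hg₂.integrable_mul hh₂
  exact (norm_integral_le_of_norm_le (f := f) hprod hf).trans hoelder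

theorem abs_integral_mul_le_sqrt_mul_sqrt {X : Type*} [MeasurableSpace X] {μ : Measure X}
    {f g : X → ℝ} (hf : Integrable (fun x => f x * f x) μ)
    (hg : Integrable (fun x => g x * g x) μ) :
    |∫ x, f x * g x ∂μ| ≤ √(∫ x, f x * f x ∂μ) * √(∫ x, g x * g x ∂μ) := by
  refine abs_integral_le_sqrt_mul_sqrt hf hg (.of_forall fun x => mul_self_nonneg _)
    (.of_forall fun x => mul_self_nonneg _) (.of_forall fun x => ?_)
  rw [Real.sqrt_mul_self_eq_abs, Real.sqrt_mul_self_eq_abs, abs_mul]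

end CauchySchwarz

/-! ### Boundedness of the interior penalty form -/

theorem le_of_ae_le_of_continuousOn {X : Type*} [TopologicalSpace X] [MeasurableSpace X]
    {μ : Measure X} [μ.IsOpenPosMeasure] {f : X → ℝ} {b : ℝ} {s t : Set X} (hs : IsOpen s)
    (hst : s ⊆ t) (hts : t ⊆ closure s) (hf : ContinuousOn f t)
    (h : ∀ᵐ x ∂μ.restrict s, f x ≤ b) {x : X} (hx : x ∈ t) : f x ≤ b := by
  have hmax : ContinuousOn (fun y => max (f y) b) t := hf.sup continuousOn_const
  have heq : EqOn (fun y => max (f y) b) (fun _ => b) s :=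
    Measure.eqOn_open_of_ae_eq (h.mono fun y hy => max_eq_right hy) hs (hmax.mono hst)
      continuousOn_const
  exact max_eq_right_iff.1 (heq.of_subset_closure hmax continuousOn_const hst hts hx)

namespace Mesh

variable {d : ℕ} {K : RefKind} {Ω ΓD : Set (Eu d)} {M : Mesh K Ω} {κ : ℝ} {p : ℕ}
  {A : Eu d → Eu d →L[ℝ] Eu d} {α β C σ : ℝ} {e : Set (Eu d)} {u v : Eu d → ℝ}

section Coefficient

theorem IsDiffusion.ae_isPositive (hA : M.IsDiffusion A α β) (hα : 0 ≤ α) :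
    ∀ᵐ x ∂volume.restrict Ω, (A x).IsPositive := by
  filter_upwards [hA.symm, hA.bounds] with x hsymm hbounds
  exact ⟨hsymm, fun v => (by positivity : 0 ≤ α * ‖v‖ ^ 2).trans (hbounds v).1⟩

theorem norm_traceFrom_le (hM : M.ShapeRegular κ) (hA : M.IsDiffusion A α β) (hα : 0 ≤ α)
    (hβ : 0 ≤ β) {x : Eu d} (hx : x ∈ M.elem T) : ‖M.traceFrom T A x‖ ≤ β := by
  have hext : M.HasContExt T A := hA.piecewise T
  refine le_of_ae_le_of_continuousOn (μ := volume) (hM.isOpen_cell T) (M.cell_subset_elem T)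
    (M.elem_subset_closure_cell T) hext.continuousOn_traceFrom.norm ?_ hx
  filter_upwards [ae_restrict_of_ae_restrict_of_subset (M.subset T) (hA.ae_isPositive hα),
    ae_restrict_of_ae_restrict_of_subset (M.subset T) hA.bounds,
    ae_restrict_mem (hM.isOpen_cell T).measurableSet] with y hpos hbounds hy
  rw [hext.traceFrom_eqOn_cell hy]
  exact norm_le_of_isPositive_of_forall_inner_le hpos hβ fun v => (hbounds v).2

theorem mul_setIntegral_norm_sq_le_gradForm (hM : M.ShapeRegular κ) (hΩ : MeasurableSet Ω)
    (hA : M.IsDiffusion A α β) (hv : v ∈ M.space p) :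
    α * ∫ x in Ω, ‖M.brokenGrad v x‖ ^ 2 ≤ M.gradForm A v v := by
  have hint : IntegrableOn (fun x => ‖M.brokenGrad v x‖ ^ 2) Ω :=
    hM.integrableOn_of_hasContExt hΩ (hasContExt_norm_sq_brokenGrad hM hv) fun x hx => by
      rw [brokenGrad_of_notMem v hx, norm_zero, zero_pow two_ne_zero]
  rw [← integral_const_mul]
  exact integral_mono_ae (hint.const_mul α) (integrableOn_inner_flux hM hΩ hA.piecewise hv hv)
    (hA.bounds.mono fun x hx => (hx _).1)

end Coefficient

section Flux

/-- The pairs of an element and a facet label of it that describe the face `e`. -/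
def sides (M : Mesh K Ω) (e : Set (Eu d)) : Finset (Fin M.card × FacetIdx d K) :=
  open scoped Classical in {s | M.facet s.1 s.2 = e}

theorem mem_sides {s : Fin M.card × FacetIdx d K} : s ∈ M.sides e ↔ M.facet s.1 s.2 = e := by
  simp only [sides, Finset.mem_filter, Finset.mem_univ, true_and]

theorem subset_elem_of_mem_sides {s : Fin M.card × FacetIdx d K} (hs : s ∈ M.sides e) :
    e ⊆ M.elem s.1 := mem_sides.1 hs ▸ M.facet_subset_elem s.1 s.2

theorem sum_sides (M : Mesh K Ω) (f : Fin M.card → ℝ) :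
    ∑ e ∈ M.faces, ∑ s ∈ M.sides e, f s.1 = Fintype.card (FacetIdx d K) * ∑ T, f T := by
  classical
  have hfiber := Finset.sum_fiberwise_of_maps_to (s := Finset.univ) (t := M.faces)
    (g := fun s : Fin M.card × FacetIdx d K => M.facet s.1 s.2)
    (fun s hs => Finset.mem_image_of_mem _ hs) fun s => f s.1
  simp only [Fintype.sum_prod_type, Finset.sum_const, Finset.card_univ, nsmul_eq_mul,
    ← Finset.mul_sum] at hfiber
  rw [← hfiber]
  refine Finset.sum_congr rfl fun e _ => Finset.sum_congr ?_ fun _ _ => rfl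
  ext s
  simp only [mem_sides, Finset.mem_filter, Finset.mem_univ, true_and]

theorem inner_normal_traceFrom_flux_sq_le (hM : M.ShapeRegular κ) (hA : M.IsDiffusion A α β)
    (hα : 0 ≤ α) (hβ : 0 ≤ β) (hv : v ∈ M.space p) (he : e ∈ M.faces) {x : Eu d}
    (hx : x ∈ M.elem T) :
    (inner ℝ (M.normal e) (M.traceFrom T (fun y => A y (M.brokenGrad v y)) x) : ℝ) ^ 2 ≤
      β ^ 2 * ‖M.traceFrom T (M.brokenGrad v) x‖ ^ 2 := by
  rw [traceFrom_flux hM (hA.piecewise T) hv hx, ← mul_pow, ← sq_abs]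
  gcongr
  calc |inner ℝ (M.normal e) (M.traceFrom T A x (M.traceFrom T (M.brokenGrad v) x))|
      ≤ ‖M.normal e‖ * ‖M.traceFrom T A x (M.traceFrom T (M.brokenGrad v) x)‖ :=
        abs_real_inner_le_norm _ _
    _ ≤ β * ‖M.traceFrom T (M.brokenGrad v) x‖ := by
        rw [norm_normal he, one_mul]
        exact ContinuousLinearMap.le_of_opNorm_le _ (norm_traceFrom_le hM hA hα hβ hx) _

theorem avgFlux_sq_le (hM : M.ShapeRegular κ) (hA : M.IsDiffusion A α β) (hα : 0 ≤ α)
    (hβ : 0 ≤ β) (hv : v ∈ M.space p) (he : e ∈ M.faces) {x : Eu d} (hx : x ∈ e) :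
    M.avgFlux A v e x ^ 2 ≤
      β ^ 2 * ∑ s ∈ M.sides e, ‖M.traceFrom s.1 (M.brokenGrad v) x‖ ^ 2 := by
  have one_side {T} {k} (hk : M.facet T k = e) :
      (inner ℝ (M.normal e) (M.traceFrom T (fun y => A y (M.brokenGrad v y)) x) : ℝ) ^ 2 ≤
        β ^ 2 * ∑ s ∈ M.sides e, ‖M.traceFrom s.1 (M.brokenGrad v) x‖ ^ 2 := by
    have hs : (T, k) ∈ M.sides e := mem_sides.2 hk
    refine (inner_normal_traceFrom_flux_sq_le hM hA hα hβ hv he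
      (subset_elem_of_mem_sides hs hx)).trans (mul_le_mul_of_nonneg_left ?_ (sq_nonneg β))
    exact Finset.single_le_sum
      (f := fun s : Fin M.card × FacetIdx d K => ‖M.traceFrom s.1 (M.brokenGrad v) x‖ ^ 2)
      (fun _ _ => sq_nonneg _) hs
  obtain ⟨k, hk⟩ := exists_facet_minus he
  by_cases hi : M.IsInterior e
  · obtain ⟨l, hl⟩ := hi.exists_facet_plus
    simp only [avgFlux, if_pos hi, div_pow]
    linarith [one_side hk, one_side hl, add_sq_le (a := inner ℝ (M.normal e)
      (M.traceFrom (M.minus e) (fun y => A y (M.brokenGrad v y)) x)) (b := inner ℝ (M.normal e)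
      (M.traceFrom (M.plus e) (fun y => A y (M.brokenGrad v y)) x))]
  · simpa only [avgFlux, if_neg hi] using one_side hk

theorem diam_mul_setIntegral_traceFrom_sq_le (htrace : M.TraceInequality p C)
    (hv : v ∈ M.space p) {s : Fin M.card × FacetIdx d K} (hs : s ∈ M.sides e) :
    Metric.diam e * ∫ x in e, ‖M.traceFrom s.1 (M.brokenGrad v) x‖ ^ 2 ∂μHE[d - 1] ≤
      C * ∫ x in M.cell s.1, ‖M.brokenGrad v x‖ ^ 2 := by
  have hdiam : Metric.diam e ≤ Metric.diam (M.elem s.1) :=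
    Metric.diam_mono (subset_elem_of_mem_sides hs) (M.isCompact_elem s.1).isBounded
  refine (mul_le_mul_of_nonneg_right hdiam
    (integral_nonneg fun _ => sq_nonneg _)).trans ?_
  simpa only [mem_sides.1 hs] using htrace v hv s.1 s.2

theorem diam_mul_setIntegral_avgFlux_sq_le (hM : M.ShapeRegular κ) (hA : M.IsDiffusion A α β)
    (hα : 0 ≤ α) (hβ : 0 ≤ β) (htrace : M.TraceInequality p C) (hv : v ∈ M.space p)
    (he : e ∈ M.faces) :
    Metric.diam e * ∫ x in e, M.avgFlux A v e x * M.avgFlux A v e x ∂μHE[d - 1] ≤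
      β ^ 2 * C * ∑ s ∈ M.sides e, ∫ x in M.cell s.1, ‖M.brokenGrad v x‖ ^ 2 := by
  have hint s (hs : s ∈ M.sides e) :
      IntegrableOn (fun x => ‖M.traceFrom s.1 (M.brokenGrad v) x‖ ^ 2) e μHE[d - 1] :=
    hM.integrableOn_face he (((hasContExt_brokenGrad hM hv s.1).continuousOn_traceFrom.mono
      (subset_elem_of_mem_sides hs)).norm.pow 2)
  have hflux := continuousOn_avgFlux hM hA.piecewise he hv
  calc Metric.diam e * ∫ x in e, M.avgFlux A v e x * M.avgFlux A v e x ∂μHE[d - 1]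
      ≤ Metric.diam e * ∫ x in e,
          β ^ 2 * ∑ s ∈ M.sides e, ‖M.traceFrom s.1 (M.brokenGrad v) x‖ ^ 2 ∂μHE[d - 1] := by
        refine mul_le_mul_of_nonneg_left ?_ Metric.diam_nonneg
        refine setIntegral_mono_on (hM.integrableOn_face he (hflux.mul hflux))
          ((integrable_finsetSum _ hint).const_mul _)
          (isCompact_of_mem_faces he).measurableSet fun x hx => ?_
        rw [← sq]
        exact avgFlux_sq_le hM hA hα hβ hv he hx
    _ = β ^ 2 * ∑ s ∈ M.sides e,
          Metric.diam e * ∫ x in e, ‖M.traceFrom s.1 (M.brokenGrad v) x‖ ^ 2 ∂μHE[d - 1] := by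
        rw [integral_const_mul, integral_finsetSum _ hint, ← Finset.mul_sum]
        ring
    _ ≤ β ^ 2 * ∑ s ∈ M.sides e, C * ∫ x in M.cell s.1, ‖M.brokenGrad v x‖ ^ 2 := by
        refine mul_le_mul_of_nonneg_left (Finset.sum_le_sum fun s hs => ?_) (sq_nonneg β)
        exact diam_mul_setIntegral_traceFrom_sq_le htrace hv hs
    _ = β ^ 2 * C * ∑ s ∈ M.sides e, ∫ x in M.cell s.1, ‖M.brokenGrad v x‖ ^ 2 := by
        rw [← Finset.mul_sum, mul_assoc]

theorem sum_diam_mul_setIntegral_avgFlux_sq_le (hM : M.ShapeRegular κ) (hΩ : MeasurableSet Ω)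
    (hA : M.IsDiffusion A α β) (hα : 0 < α) (hβ : 0 ≤ β) (hC : 0 ≤ C)
    (htrace : M.TraceInequality p C) (hv : v ∈ M.space p) :
    ∑ e ∈ M.faces, Metric.diam e *
        ∫ x in e, M.avgFlux A v e x * M.avgFlux A v e x ∂μHE[d - 1] ≤
      β ^ 2 / α * (C * Fintype.card (FacetIdx d K) * M.gradForm A v v) := by
  calc _ ≤ ∑ e ∈ M.faces,
        β ^ 2 * C * ∑ s ∈ M.sides e, ∫ x in M.cell s.1, ‖M.brokenGrad v x‖ ^ 2 :=
        Finset.sum_le_sum fun e he =>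
          diam_mul_setIntegral_avgFlux_sq_le hM hA hα.le hβ htrace hv he
    _ = β ^ 2 * C * (Fintype.card (FacetIdx d K) * ∫ x in Ω, ‖M.brokenGrad v x‖ ^ 2) := by
        rw [← Finset.mul_sum, sum_sides M fun T => ∫ x in M.cell T, ‖M.brokenGrad v x‖ ^ 2,
          ← hM.setIntegral_eq_sum_cell hΩ (hasContExt_norm_sq_brokenGrad hM hv)]
        intro x hx
        rw [brokenGrad_of_notMem v hx, norm_zero, zero_pow two_ne_zero]
    _ = β ^ 2 / α * (C * Fintype.card (FacetIdx d K) *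
          (α * ∫ x in Ω, ‖M.brokenGrad v x‖ ^ 2)) := by field_simp
    _ ≤ β ^ 2 / α * (C * Fintype.card (FacetIdx d K) * M.gradForm A v v) := by
        gcongr
        exact mul_setIntegral_norm_sq_le_gradForm hM hΩ hA hv

end Flux

section Bounded

theorem gradForm_self_nonneg (hA : M.IsDiffusion A α β) (hα : 0 ≤ α) (v : Eu d → ℝ) :
    0 ≤ M.gradForm A v v :=
  integral_nonneg_of_ae ((hA.ae_isPositive hα).mono fun _ hx => hx.inner_nonneg_left _)

theorem penaltyForm_self_nonneg (M : Mesh K Ω) (ΓD : Set (Eu d)) (hσ : 0 ≤ σ) (v : Eu d → ℝ) :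
    0 ≤ M.penaltyForm ΓD σ v v :=
  Finset.sum_nonneg fun _ _ => mul_nonneg (div_nonneg hσ Metric.diam_nonneg)
    (integral_nonneg fun _ => mul_self_nonneg _)

theorem abs_gradForm_le (hM : M.ShapeRegular κ) (hΩ : MeasurableSet Ω)
    (hA : M.IsDiffusion A α β) (hα : 0 ≤ α) (hu : u ∈ M.space p) (hv : v ∈ M.space p) :
    |M.gradForm A u v| ≤ √(M.gradForm A u u) * √(M.gradForm A v v) := by
  have hpos := hA.ae_isPositive hα
  refine abs_integral_le_sqrt_mul_sqrt (integrableOn_inner_flux hM hΩ hA.piecewise hu hu)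
    (integrableOn_inner_flux hM hΩ hA.piecewise hv hv)
    (hpos.mono fun _ hx => hx.inner_nonneg_left _) (hpos.mono fun _ hx => hx.inner_nonneg_left _)
    (hpos.mono fun x hx => ?_)
  rw [← Real.sqrt_mul (hx.inner_nonneg_left _)]
  exact Real.abs_le_sqrt (inner_apply_sq_le_of_isPositive hx _ _)

theorem abs_penaltyForm_le (hM : M.ShapeRegular κ) (ΓD : Set (Eu d)) (hσ : 0 ≤ σ)
    (hu : u ∈ M.space p) (hv : v ∈ M.space p) :
    |M.penaltyForm ΓD σ u v| ≤ √(M.penaltyForm ΓD σ u u) * √(M.penaltyForm ΓD σ v v) := by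
  have hweight (e : Set (Eu d)) : 0 ≤ σ / Metric.diam e := div_nonneg hσ Metric.diam_nonneg
  have hnonneg (w : Eu d → ℝ) (e : Set (Eu d)) :
      0 ≤ σ / Metric.diam e * ∫ x in e, M.jump w e x * M.jump w e x ∂μHE[d - 1] :=
    mul_nonneg (hweight e) (integral_nonneg fun _ => mul_self_nonneg _)
  refine (Finset.abs_sum_le_sum_abs _ _).trans ((Finset.sum_le_sum fun e he => ?_).trans
    (Real.sum_sqrt_mul_sqrt_le _ (hnonneg u) (hnonneg v)))
  have he' := mem_faces_of_mem_dgFaces he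
  rw [abs_mul, abs_of_nonneg (hweight e), Real.sqrt_mul (hweight e), Real.sqrt_mul (hweight e),
    mul_mul_mul_comm, Real.mul_self_sqrt (hweight e)]
  exact mul_le_mul_of_nonneg_left (abs_integral_mul_le_sqrt_mul_sqrt
    (integrableOn_jump_mul_jump hM he' hu hu) (integrableOn_jump_mul_jump hM he' hv hv)) (hweight e)

theorem restrict_eq_zero_of_diam_eq_zero (hd : 2 ≤ d) (he : e ∈ M.faces)
    (hdiam : Metric.diam e = 0) : (μHE[d - 1] : Measure (Eu d)).restrict e = 0 := by
  have hsub : e.Subsingleton := fun x hx y hy => dist_le_zero.1 <|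
    (Metric.dist_le_diam_of_mem (isCompact_of_mem_faces he).isBounded hx hy).trans_eq hdiam
  have := Measure.nullSingletonClass_hausdorff (X := Eu d) (d := ((d - 1 : ℕ) : ℝ))
    (by exact_mod_cast (by omega : 0 < d - 1))
  rw [Measure.restrict_eq_zero, Measure.euclideanHausdorffMeasure_def, Measure.smul_apply,
    hsub.measure_zero, smul_zero]

theorem abs_setIntegral_avgFlux_mul_jump_le (hd : 2 ≤ d) (hM : M.ShapeRegular κ)
    (hA : ∀ T, M.HasContExt T A) (hσ : 0 < σ) (hu : u ∈ M.space p) (hv : v ∈ M.space p)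
    (he : e ∈ M.faces) :
    |∫ x in e, M.avgFlux A u e x * M.jump v e x ∂μHE[d - 1]| ≤
      √(Metric.diam e / σ * ∫ x in e, M.avgFlux A u e x * M.avgFlux A u e x ∂μHE[d - 1]) *
        √(σ / Metric.diam e * ∫ x in e, M.jump v e x * M.jump v e x ∂μHE[d - 1]) := by
  -- For `diam e = 0` the junk weight `σ / 0 = 0` is harmless only because `e` is then a null set.
  obtain hdiam | hdiam := (Metric.diam_nonneg (s := e)).eq_or_lt
  · simp only [restrict_eq_zero_of_diam_eq_zero hd he hdiam.symm, integral_zero_measure, abs_zero]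
    positivity
  have hflux := continuousOn_avgFlux hM hA he hu
  rw [Real.sqrt_mul (by positivity), Real.sqrt_mul (by positivity), mul_mul_mul_comm,
    ← Real.sqrt_mul (by positivity), div_mul_div_comm, mul_comm σ,
    div_self (mul_pos hdiam hσ).ne', Real.sqrt_one, one_mul]
  exact abs_integral_mul_le_sqrt_mul_sqrt (hM.integrableOn_face he (hflux.mul hflux))
    (integrableOn_jump_mul_jump hM he hv hv)

theorem abs_fluxForm_le (hd : 2 ≤ d) (hM : M.ShapeRegular κ) (hΩ : MeasurableSet Ω)
    (hA : M.IsDiffusion A α β) (hα : 0 < α) (hβ : 0 < β) (hC : 0 ≤ C)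
    (htrace : M.TraceInequality p C) (ΓD : Set (Eu d)) (hσ : β ^ 2 / α ≤ σ)
    (hu : u ∈ M.space p) (hv : v ∈ M.space p) :
    |M.fluxForm ΓD A u v| ≤
      √(C * Fintype.card (FacetIdx d K) * M.gradForm A u u) * √(M.penaltyForm ΓD σ v v) := by
  have hσ₀ : 0 < σ := (by positivity : 0 < β ^ 2 / α).trans_le hσ
  have hflux₀ (e : Set (Eu d)) :
      0 ≤ Metric.diam e / σ * ∫ x in e, M.avgFlux A u e x * M.avgFlux A u e x ∂μHE[d - 1] :=
    mul_nonneg (div_nonneg Metric.diam_nonneg hσ₀.le) (integral_nonneg fun _ => mul_self_nonneg _)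
  have hjump₀ (e : Set (Eu d)) :
      0 ≤ σ / Metric.diam e * ∫ x in e, M.jump v e x * M.jump v e x ∂μHE[d - 1] :=
    mul_nonneg (div_nonneg hσ₀.le Metric.diam_nonneg) (integral_nonneg fun _ => mul_self_nonneg _)
  have hgrad₀ := gradForm_self_nonneg hA hα.le u
  refine (Finset.abs_sum_le_sum_abs _ _).trans ((Finset.sum_le_sum fun e he =>
    abs_setIntegral_avgFlux_mul_jump_le hd hM hA.piecewise hσ₀ hu hv
      (mem_faces_of_mem_dgFaces he)).trans ((Real.sum_sqrt_mul_sqrt_le _ hflux₀ hjump₀).trans ?_))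
  refine mul_le_mul_of_nonneg_right (Real.sqrt_le_sqrt ?_) (Real.sqrt_nonneg _)
  calc _ ≤ ∑ e ∈ M.faces, Metric.diam e / σ *
          ∫ x in e, M.avgFlux A u e x * M.avgFlux A u e x ∂μHE[d - 1] :=
        Finset.sum_le_sum_of_subset_of_nonneg (fun _ => mem_faces_of_mem_dgFaces)
          fun e _ _ => hflux₀ e
    _ = (∑ e ∈ M.faces, Metric.diam e *
          ∫ x in e, M.avgFlux A u e x * M.avgFlux A u e x ∂μHE[d - 1]) / σ := by
        simp only [Finset.sum_div, div_mul_eq_mul_div]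
    _ ≤ C * Fintype.card (FacetIdx d K) * M.gradForm A u u := by
        rw [div_le_iff₀' hσ₀]
        refine (sum_diam_mul_setIntegral_avgFlux_sq_le hM hΩ hA hα hβ.le hC htrace hu).trans ?_
        gcongr

theorem exists_abs_form_le (hd : 2 ≤ d) (K : RefKind) (p : ℕ) (κ : ℝ) : ∃ C : ℝ, 0 ≤ C ∧
    ∀ α β : ℝ, 0 < α → 0 < β → ∀ (Ω ΓD : Set (Eu d)), MeasurableSet Ω → ∀ M : Mesh K Ω,
      M.ShapeRegular κ → ∀ A : Eu d → Eu d →L[ℝ] Eu d, M.IsDiffusion A α β →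
      ∀ σ : ℝ, β ^ 2 / α ≤ σ → ∀ u ∈ M.space p, ∀ v ∈ M.space p,
        |M.form ΓD A σ u v| ≤ C * (M.energyNorm ΓD A σ u * M.energyNorm ΓD A σ v) := by
  obtain ⟨C, hC, htrace⟩ := exists_traceInequality (d := d) (by omega) K p κ
  let D : ℝ := C * Fintype.card (FacetIdx d K)
  have hD : 0 ≤ D := by positivity
  refine ⟨2 + 2 * √D, by positivity, fun α β hα hβ Ω ΓD hΩ M hM A hA σ hσ u hu v hv => ?_⟩
  have hσ₀ : 0 ≤ σ := (by positivity : 0 ≤ β ^ 2 / α).trans hσ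
  have hgrad (w : Eu d → ℝ) : √(M.gradForm A w w) ≤ M.energyNorm ΓD A σ w := by
    rw [energyNorm_eq]
    exact Real.sqrt_le_sqrt (le_add_of_nonneg_right (penaltyForm_self_nonneg M ΓD hσ₀ w))
  have hpenalty (w : Eu d → ℝ) : √(M.penaltyForm ΓD σ w w) ≤ M.energyNorm ΓD A σ w := by
    rw [energyNorm_eq]
    exact Real.sqrt_le_sqrt (le_add_of_nonneg_left (gradForm_self_nonneg hA hα.le w))
  have henergy (w : Eu d → ℝ) : 0 ≤ M.energyNorm ΓD A σ w := Real.sqrt_nonneg _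
  have hvolume : |M.gradForm A u v| ≤ M.energyNorm ΓD A σ u * M.energyNorm ΓD A σ v :=
    (abs_gradForm_le hM hΩ hA hα.le hu hv).trans
      (mul_le_mul (hgrad u) (hgrad v) (Real.sqrt_nonneg _) (henergy u))
  have hjumps : |M.penaltyForm ΓD σ u v| ≤ M.energyNorm ΓD A σ u * M.energyNorm ΓD A σ v :=
    (abs_penaltyForm_le hM ΓD hσ₀ hu hv).trans
      (mul_le_mul (hpenalty u) (hpenalty v) (Real.sqrt_nonneg _) (henergy u))
  have hflux {w z} (hw : w ∈ M.space p) (hz : z ∈ M.space p) :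
      |M.fluxForm ΓD A w z| ≤ √D * (M.energyNorm ΓD A σ w * M.energyNorm ΓD A σ z) := by
    refine (abs_fluxForm_le hd hM hΩ hA hα hβ hC (htrace Ω M hM) ΓD hσ hw hz).trans ?_
    rw [Real.sqrt_mul hD, mul_assoc]
    gcongr
    exacts [henergy w, hgrad w, hpenalty z]
  have huv := hflux hu hv
  have hvu := hflux hv hu
  rw [mul_comm (M.energyNorm ΓD A σ v)] at hvu
  rw [form_eq, abs_le]
  rw [abs_le] at hvolume hjumps huv hvu
  constructor <;> linarith

end Bounded

end Mesh

/-! ### The multiscale space -/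

section AffineMap

variable {E F : Type*} [NormedAddCommGroup E] [NormedSpace ℝ E] [NormedAddCommGroup F]
  [NormedSpace ℝ F]

theorem injective_affineMap_of_injOn {S : E →ᵃ[ℝ] F} {s : Set E} (hs : (interior s).Nonempty)
    (hS : InjOn S s) : Function.Injective S := by
  obtain ⟨x₀, hx₀⟩ := hs
  rw [← S.linear_injective_iff, ← LinearMap.ker_eq_bot, LinearMap.ker_eq_bot']
  intro ξ hξ
  have hnear : ∀ᶠ t : ℝ in 𝓝[≠] 0, t • ξ +ᵥ x₀ ∈ s := by
    have hcont : ContinuousAt (fun t : ℝ => t • ξ +ᵥ x₀) 0 := by fun_prop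
    refine (hcont.eventually_mem ?_).filter_mono nhdsWithin_le_nhds
    rw [zero_smul, zero_vadd]
    exact mem_interior_iff_mem_nhds.1 hx₀
  obtain ⟨t, ht, ht₀⟩ := (hnear.and self_mem_nhdsWithin).exists
  have hsame : S (t • ξ +ᵥ x₀) = S x₀ := by rw [S.map_vadd, map_smul, hξ, smul_zero, zero_vadd]
  have := hS ht (interior_subset hx₀) hsame
  rw [vadd_eq_add, add_eq_right] at this
  exact (smul_eq_zero.1 this).resolve_left ht₀

theorem mapsTo_interior_of_injOn_affineMap [FiniteDimensional ℝ E] {S : E →ᵃ[ℝ] E} {s t : Set E}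
    (hst : MapsTo S s t) (hS : InjOn S s) : MapsTo S (interior s) (interior t) := by
  intro x hx
  have : CompleteSpace E := FiniteDimensional.complete ℝ E
  have hsurj : Function.Surjective S := S.linear_surjective_iff.1
    (LinearMap.surjective_of_injective
      (S.linear_injective_iff.2 (injective_affineMap_of_injOn ⟨x, hx⟩ hS)))
  exact (S.isOpenMap S.continuous_of_finiteDimensional hsurj).mapsTo_interior hst hx

end AffineMap

section Multiscale

variable {d : ℕ} {K : RefKind} {Ω ΓD : Set (Eu d)} {M MH Mh : Mesh K Ω} {κ α β σ : ℝ}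
  {A : Eu d → Eu d →L[ℝ] Eu d} {p : ℕ}

theorem exists_refPoly_simplex_affineMap (S : Eu d →ᵃ[ℝ] Eu d) (i : Fin d) :
    ∃ q ∈ refPoly d .simplex 1, ∀ x, S x i = evalAt x q := by
  let a (j : Fin d) : ℝ := S.linear (EuclideanSpace.single j 1) i
  refine ⟨MvPolynomial.C (S 0 i) + ∑ j, MvPolynomial.C (a j) * MvPolynomial.X j, ?_, fun x => ?_⟩
  · refine Submodule.add_mem _ ?_ (Submodule.sum_mem _ fun j _ => ?_)
    · exact (MvPolynomial.mem_restrictTotalDegree _ _ _).2 (by simp)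
    · exact (MvPolynomial.mem_restrictTotalDegree _ _ _).2
        ((MvPolynomial.totalDegree_mul _ _).trans (by simp))
  · have hlinear : S.linear x i = ∑ j, a j * x j := by
      conv_lhs => rw [← (EuclideanSpace.basisFun (Fin d) ℝ).sum_repr x]
      simp [a, mul_comm]
    rw [S.decomp, Pi.add_apply, PiLp.add_apply, hlinear]
    simp [evalAt, add_comm]

theorem exists_refPoly_refLagrange_simplex_comp (S : Eu d →ᵃ[ℝ] Eu d)
    (j : VertexIdx d .simplex) :
    ∃ q ∈ refPoly d .simplex 1, ∀ x, refLagrange d .simplex j (S x) = evalAt x q := by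
  match j with
  | some i => exact exists_refPoly_simplex_affineMap S i
  | none =>
    choose q hq hSq using exists_refPoly_simplex_affineMap S
    refine ⟨1 - ∑ i, q i, Submodule.sub_mem _ ?_ (Submodule.sum_mem _ fun i _ => hq i),
      fun x => by simp [refLagrange, evalAt, hSq]⟩
    exact (MvPolynomial.mem_restrictTotalDegree _ _ _).2 (by simp)

theorem prod_mem_refPoly_cube (π : Equiv.Perm (Fin d)) (a b : Fin d → ℝ) :
    ∏ i, (MvPolynomial.C (a i) + MvPolynomial.C (b i) * MvPolynomial.X (π i)) ∈
      refPoly d .cube 1 := by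
  refine (MvPolynomial.mem_restrictDegree_iff_sup _ _ _).2 fun k => ?_
  rw [← MvPolynomial.degreeOf_def]
  have hfactor i : MvPolynomial.degreeOf k
      (MvPolynomial.C (a i) + MvPolynomial.C (b i) * MvPolynomial.X (π i)) ≤
        if i = π.symm k then 1 else 0 := by
    refine (MvPolynomial.degreeOf_add_le _ _ _).trans ?_
    rw [MvPolynomial.degreeOf_C, Nat.zero_max]
    refine (MvPolynomial.degreeOf_C_mul_le _ _ _).trans_eq ?_
    simp only [MvPolynomial.degreeOf_X, Equiv.eq_symm_apply, eq_comm]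
  refine (MvPolynomial.degreeOf_prod_le _ _ _).trans
    ((Finset.sum_le_sum fun i _ => hfactor i).trans_eq ?_)
  rw [Finset.sum_ite_eq' Finset.univ, if_pos (Finset.mem_univ _)]

theorem exists_refPoly_refLagrange_cube_comp {S : Eu d → Eu d} (π : Equiv.Perm (Fin d))
    (hS : ∀ i, ∃ a b : ℝ, ∀ x, S x i = a + b * x (π i)) (c : VertexIdx d .cube) :
    ∃ q ∈ refPoly d .cube 1, ∀ x, refLagrange d .cube c (S x) = evalAt x q := by
  choose a b hab using hS
  change Fin d → Bool at c
  refine ⟨_, prod_mem_refPoly_cube π (fun i => if c i then a i else 1 - a i)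
    (fun i => if c i then b i else -b i), fun x => ?_⟩
  simp only [refLagrange, evalAt, map_prod]
  refine Finset.prod_congr rfl fun i _ => ?_
  simp only [hab, map_add, map_mul, MvPolynomial.eval_C, MvPolynomial.eval_X]
  split_ifs
  · rfl
  · ring

theorem exists_refPoly_refLagrange_comp {S : Eu d →ᵃ[ℝ] Eu d}
    (hcube : K = .cube → ∃ π : Equiv.Perm (Fin d), ∀ i, ∃ a b : ℝ, ∀ x, S x i = a + b * x (π i))
    (j : VertexIdx d K) : ∃ q ∈ refPoly d K 1, ∀ x, refLagrange d K j (S x) = evalAt x q := by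
  cases K with
  | simplex => exact exists_refPoly_refLagrange_simplex_comp S j
  | cube =>
    obtain ⟨π, hπ⟩ := hcube rfl
    exact exists_refPoly_refLagrange_cube_comp π hπ j

theorem lagrange_mem_space (href : MH.IsRefinedBy Mh) (T : Fin MH.card) (j : VertexIdx d K) :
    MH.lagrange T j ∈ Mh.space 1 := by
  intro t
  obtain ⟨T', S, hS, hcube, hmap⟩ := href t
  have hinj : InjOn S (refElem d K) := fun x hx y hy hxy =>
    Mh.map_inj t hx hy (by rw [hmap x hx, hmap y hy, hxy])
  have hinterior := mapsTo_interior_of_injOn_affineMap hS hinj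
  have hcell {x} (hx : x ∈ interior (refElem d K)) : MH.map T' (S x) ∈ MH.cell T' :=
    mem_image_of_mem _ (hinterior hx)
  by_cases hT : T' = T
  · subst hT
    obtain ⟨q, hq, hSq⟩ := exists_refPoly_refLagrange_comp hcube j
    refine ⟨q, hq, fun x hx => ?_⟩
    rw [hmap x (interior_subset hx), Mesh.lagrange, if_pos (hcell hx),
      (MH.map_inj T').leftInvOn_invFunOn (interior_subset (hinterior hx)), hSq]
  · refine ⟨0, Submodule.zero_mem _, fun x hx => ?_⟩
    rw [hmap x (interior_subset hx), Mesh.lagrange,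
      if_neg (disjoint_left.1 (MH.pairwise_disjoint_cell hT) (hcell hx)), evalAt, map_zero]

theorem msSpace_le {L : ℕ} {φ : Fin MH.card → VertexIdx d K → Eu d → ℝ}
    (href : MH.IsRefinedBy Mh) (hφ : AreCorrectors MH Mh ΓD A σ L φ) :
    msSpace MH φ ≤ Mh.space 1 :=
  Submodule.span_le.2 <| range_subset_iff.2 fun s =>
    Submodule.sub_mem _ (lagrange_mem_space href s.1 s.2) (hφ s.1 s.2).1.1.1

/-! ### Galerkin orthogonality -/

theorem functional_sub_eq_form (hM : M.ShapeRegular κ) (hΩ : MeasurableSet Ω)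
    (hA : M.IsDiffusion A α β) {V : Submodule ℝ (Eu d → ℝ)} (hV : V ≤ M.space p)
    {f g u uV φ φV : Eu d → ℝ} (hu : IsGalerkin M ΓD A σ f (M.space p) u)
    (huV : IsGalerkin M ΓD A σ f V uV) (hφ : IsDualGalerkin M ΓD A σ g (M.space p) φ)
    (hφV : IsDualGalerkin M ΓD A σ g V φV) :
    functional Ω g u - functional Ω g uV = M.form ΓD A σ (u - uV) (φ - φV) := by
  have huV' := hV huV.1
  have hφV' := hV hφV.1
  have horth : M.form ΓD A σ (u - uV) φV = 0 := by
    rw [Mesh.form_sub_left hM hΩ hA.piecewise ΓD σ hu.1 huV' hφV', hu.2 φV hφV',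
      huV.2 φV hφV.1, sub_self]
  rw [Mesh.form_sub_right hM hΩ hA ΓD σ (Submodule.sub_mem _ hu.1 huV') hφ.1 hφV', horth, sub_zero,
    Mesh.form_sub_left hM hΩ hA.piecewise ΓD σ hu.1 huV' hφ.1, hφ.2 u hu.1, hφ.2 uV huV']

end Multiscale

end DGMultiscale

end

open MeasureTheory DGMultiscale in
theorem mainTheorem5_general {d : ℕ} (hd : 2 ≤ d) (K : RefKind) (p : ℕ) (κ : ℝ) :
    ∃ C : ℝ, 0 ≤ C ∧ ∀ α β : ℝ, 0 < α → α ≤ β → ∃ σ₀ : ℝ, 0 < σ₀ ∧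
      ∀ Ω ΓD : Set (Eu d), MeasurableSet Ω →
      ∀ M : Mesh K Ω, M.ShapeRegular κ →
      ∀ A : Eu d → Eu d →L[ℝ] Eu d, M.IsDiffusion A α β →
      ∀ σ : ℝ, σ₀ ≤ σ →
      ∀ f g u : Eu d → ℝ, MemLp f 2 (volume.restrict Ω) → MemLp g 2 (volume.restrict Ω) →
        MemLp u 2 (volume.restrict Ω) →
      ∀ V : Submodule ℝ (Eu d → ℝ), V ≤ M.space p →
      ∀ uh uV φh φV : Eu d → ℝ,
        IsGalerkin M ΓD A σ f (M.space p) uh → IsGalerkin M ΓD A σ f V uV →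
        IsDualGalerkin M ΓD A σ g (M.space p) φh → IsDualGalerkin M ΓD A σ g V φV →
        |functional Ω g u - functional Ω g uV| ≤
          |functional Ω g u - functional Ω g uh| +
            C * (M.energyNorm ΓD A σ (uh - uV) * M.energyNorm ΓD A σ (φh - φV)) := by
  obtain ⟨C, hC, hbound⟩ := Mesh.exists_abs_form_le hd K p κ
  refine ⟨C, hC, fun α β hα hαβ => ?_⟩
  have hβ : 0 < β := hα.trans_le hαβ
  refine ⟨β ^ 2 / α, by positivity, ?_⟩
  intro Ω ΓD hΩ M hM A hA σ hσ f g u _ _ _ V hV uh uV φh φV huh huV hφh hφV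
  have herror := functional_sub_eq_form hM hΩ hA hV huh huV hφh hφV
  refine (abs_sub_le _ (functional Ω g uh) _).trans (add_le_add_right ?_ _)
  rw [herror]
  exact hbound α β hα hβ Ω ΓD hΩ M hM A hA σ hσ _ (Submodule.sub_mem _ huh.1 (hV huV.1)) _
    (Submodule.sub_mem _ hφh.1 (hV hφV.1))

open MeasureTheory DGMultiscale in
theorem mainTheorem5 {d : ℕ} (hd : 2 ≤ d) (K : RefKind) (κ : ℝ) :
    ∃ C : ℝ, 0 ≤ C ∧ ∀ α β : ℝ, 0 < α → α ≤ β → ∃ σ₀ : ℝ, 0 < σ₀ ∧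
      ∀ (Ω ΓD : Set (Eu d)), IsPolyhedralLipschitzDomain Ω →
        IsClosed ΓD → ΓD.Nonempty → ΓD ⊆ frontier Ω →
      ∀ (MH Mh : Mesh K Ω), MH.ShapeRegular κ → Mh.ShapeRegular κ →
        MH.IsRefinedBy Mh → Mh.Resolves ΓD →
      ∀ A : Eu d → Eu d →L[ℝ] Eu d, Mh.IsDiffusion A α β →
      ∀ σ : ℝ, σ₀ ≤ σ →
      ∀ f g : Eu d → ℝ, MemLp f 2 (volume.restrict Ω) → MemLp g 2 (volume.restrict Ω) →
      ∀ L : ℕ, 1 ≤ L →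
      ∀ φL : Fin MH.card → VertexIdx d K → Eu d → ℝ, AreCorrectors MH Mh ΓD A σ L φL →
      ∀ u uh uH φh φH : Eu d → ℝ,
        IsWeakSolution Ω ΓD A f u →
        IsGalerkin Mh ΓD A σ f (Mh.space 1) uh →
        IsGalerkin Mh ΓD A σ f (msSpace MH φL) uH →
        IsDualGalerkin Mh ΓD A σ g (Mh.space 1) φh →
        IsDualGalerkin Mh ΓD A σ g (msSpace MH φL) φH →
        |functional Ω g u - functional Ω g uH| ≤
          |functional Ω g u - functional Ω g uh| +
            C * (Mh.energyNorm ΓD A σ (uh - uH) * Mh.energyNorm ΓD A σ (φh - φH)) := by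
  obtain ⟨C, hC, hgeneral⟩ := mainTheorem5_general hd K 1 κ
  refine ⟨C, hC, fun α β hα hαβ => ?_⟩
  obtain ⟨σ₀, hσ₀, hestimate⟩ := hgeneral α β hα hαβ
  refine ⟨σ₀, hσ₀, ?_⟩
  intro Ω ΓD hΩ _ _ _ MH Mh _ hMh href _ A hA σ hσ f g hf hg L _ φL hφL u uh uH φh φH
  rintro ⟨G, hu, -⟩
  exact hestimate Ω ΓD hΩ.isOpen.measurableSet Mh hMh A hA σ hσ f g u hf hg hu.1.memLp
    (msSpace MH φL) (msSpace_le href hφL) uh uH φh φH
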